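/- For $s\in\mathbb{C}$ write $s=\sigma+it$ with $\sigma,t\in\mathbb{R}$. Let $$\mathcal{R}(s)=\int_{0\swarrow1}\frac{x^{-s}e^{\pi i x^2}}{e^{\pi i x}-e^{-\pi i x}}\,dx$$ be Riemann's auxiliary function, where $0\swarrow1$ denotes the line through $\tfrac12$ of slope $1$, run through from the upper right to the lower left, and $x^{-s}$ is the principal branch. Let $\chi(s)=2^s\pi^{s-1}\sin(\pi s/2)\,\Gamma(1-s)$, so that $\zeta(s)=\chi(s)\zeta(1-s)$, and, for $0<\arg(s-1)<2\pi$, let $\eta=\eta(s)=\sqrt{\frac{s-1}{2\pi i}}$ with $-\frac{\pi}{4}<\arg\eta<\frac{3\pi}{4}$. Let $D$ be the set of all $s$ with $1-\sigma>|t|$ and $|s-1|\ge 3528\pi$. Then a point $s\in D$ is a zero of $\mathcal{R}$ if and only if $s=-2n$ for some positive integer $n$. Moreover, there is a continuous function $U\colon D\to\mathbb{C}$ such that for all $s\in D$ $$\mathcal{R}(s)=-\chi(s)\,\eta^{s-1}e^{-\pi i\eta^2}\,\frac{\sqrt2\,e^{3\pi i/8}\sin\pi\eta}{2\cos2\pi\eta}\,\bigl(1+U(s)\bigr),\qquad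 |U(s)|<1,$$ where $\eta^{s-1}$ is the principal branch. -/

import Mathlib

noncomputable section

namespace RiemannAux

open Complex

/-- The point `1/2 + r e^{iπ/4}` of the line of slope one that crosses the real axis at `1/2`. -/
def path (r : ℝ) : ℂ := 1 / 2 + (r : ℂ) * exp (Real.pi * I / 4)

/-- The integrand `x^{-s} e^{πix²} / (e^{πix} - e^{-πix})`, with the principal branch of `x^{-s}`. -/
def integrand (s x : ℂ) : ℂ :=
  x ^ (-s) * exp (Real.pi * I * x ^ 2) / (exp (Real.pi * I * x) - exp (-(Real.pi * I * x)))

/-- Riemann's auxiliary function `R(s) = ∫_{0↙1} x^{-s} e^{πix²} / (e^{πix} - e^{-πix}) dx`.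
The line is run through from the upper right to the lower left, that is, with `r` decreasing
from `+∞` to `-∞`; this accounts for the minus sign. -/
def auxR (s : ℂ) : ℂ :=
  -∫ r : ℝ, integrand s (path r) * exp (Real.pi * I / 4)

/-- The factor `χ(s) = 2^s π^{s-1} sin(πs/2) Γ(1-s)` of the functional equation
`ζ(s) = χ(s) ζ(1-s)`. -/
def chi (s : ℂ) : ℂ :=
  2 ^ s * (Real.pi : ℂ) ^ (s - 1) * sin (Real.pi * s / 2) * Gamma (1 - s)

/-- The square root `η` of `(s-1)/(2πi)` with `-π/4 < arg η < 3π/4`, for `0 < arg (s-1) < 2π`.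
As `(s-1)/(2πi) = i (1-s)/(2π)`, it is `e^{iπ/4}` times the principal root of `(1-s)/(2π)`. -/
def eta (s : ℂ) : ℂ :=
  exp (Real.pi * I / 4) * ((1 - s) / (2 * Real.pi)) ^ (1 / 2 : ℂ)

theorem eta_sq (s : ℂ) : eta s ^ 2 = (s - 1) / (2 * Real.pi * I) := by
  have h1 : exp (Real.pi * I / 4) ^ 2 = I := by
    rw [← exp_nat_mul]
    refine Eq.trans (congrArg exp ?_) exp_pi_div_two_mul_I
    push_cast
    ring
  have h2 : (((1 - s) / (2 * Real.pi)) ^ (1 / 2 : ℂ)) ^ 2 = (1 - s) / (2 * Real.pi) := by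
    rw [one_div]
    exact cpow_nat_inv_pow _ two_ne_zero
  have hpi : (Real.pi : ℂ) ≠ 0 := ofReal_ne_zero.mpr Real.pi_ne_zero
  rw [eta, mul_pow, h1, h2]
  field_simp
  rw [I_sq]
  ring

theorem eta_arg {s : ℂ} (hs : 1 - s ∈ slitPlane) :
    -(Real.pi / 4) < (eta s).arg ∧ (eta s).arg < 3 * Real.pi / 4 := by
  have hpi := Real.pi_pos
  have harg : ((1 - s) / (2 * Real.pi)).arg = (1 - s).arg := by
    have : (1 - s) / (2 * Real.pi) = (((2 * Real.pi)⁻¹ : ℝ) : ℂ) * (1 - s) := by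
      push_cast
      rw [div_eq_mul_inv, mul_comm]
    rw [this, arg_real_mul _ (by positivity)]
  have hne : (1 - s) / (2 * Real.pi) ≠ 0 :=
    div_ne_zero (slitPlane_ne_zero hs) (by simp [Real.pi_ne_zero])
  have h := (mem_slitPlane_iff_arg.mp hs).1
  have hlt : (1 - s).arg < Real.pi := lt_of_le_of_ne (arg_le_pi _) h
  have hgt := neg_pi_lt_arg (1 - s)
  have him : (Real.pi * I / 4 + log ((1 - s) / (2 * Real.pi)) * (1 / 2)).im
      = Real.pi / 4 + (1 - s).arg / 2 := by
    have : Real.pi * I / 4 + log ((1 - s) / (2 * Real.pi)) * (1 / 2)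
        = ((Real.pi / 4 : ℝ) : ℂ) * I + ((1 / 2 : ℝ) : ℂ) * log ((1 - s) / (2 * Real.pi)) := by
      push_cast
      ring
    rw [this, add_im, im_ofReal_mul, im_ofReal_mul, log_im, harg, I_im]
    ring
  have : (eta s).arg = Real.pi / 4 + (1 - s).arg / 2 := by
    rw [eta, cpow_def_of_ne_zero hne, ← exp_add, arg_exp, him, toIocMod_eq_self]
    constructor <;> linarith
  constructor <;> linarith

/-- The region `1 - σ > |t|`, `|s - 1| ≥ 3528π`, where `s = σ + it`. -/
def region : Set ℂ := {s | |s.im| < 1 - s.re ∧ 3528 * Real.pi ≤ ‖s - 1‖}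

/-- The main term
`-χ(s) η^{s-1} e^{-πiη²} √2 e^{3πi/8} sin(πη) / (2 cos(2πη))`. -/
def mainTerm (s : ℂ) : ℂ :=
  -chi s * eta s ^ (s - 1) * exp (-(Real.pi * I * eta s ^ 2)) *
    (((Real.sqrt 2 : ℝ) : ℂ) * exp (3 * Real.pi * I / 8) * sin (Real.pi * eta s) /
      (2 * cos (2 * Real.pi * eta s)))

end RiemannAux

end

noncomputable section

namespace RiemannAux

open Complex MeasureTheory Filter Topology Set
open scoped Interval Real

/-!
For `Re s < -1` the line of integration can be moved to the parallel through `0`, on which the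
integrand at `±ωy`, `ω = e^{πi/4}`, is a constant times `y^{-s} e^{-πy²} / sin (πωy)`. So `R(s)` is
`sin (πs/2)` times an exponential times the Mellin transform of `e^{-πy²} / sin (πωy)` at
`w = 1 - s`.

Expanding `1 / sin` in powers of `e^{iπωy}` gives integrals of `y^{w-1} e^{-πy²+2παy}` with
`α = (2k+1)iω/2`. Writing the Gaussian as an integral over a vertical line `g = c + ir` and
exchanging the integrations turns each of them into `Γ(w) (2π)^{-w} ∫ g^{-w} e^{π(g+α)²} dr`. The
factor `g^{-w} e^{πg²}` has its saddle point at the `h` with `2πh² = w`, where `η = ωh`; along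
`g = h + ir` it decays like a Gaussian.

The term `k = 0` is its saddle point approximation with a relative error of at most `0.31`. All the
other terms together add less than `0.09`: for `2k + 1 ≤ 2.8 |h|` by the Gaussian bound on the
saddle line, for larger `k` by moving the line to `c = -Re α`, where `|e^{π(g+α)²}| ≤ 1` and
`|g^{-w}|` is small because `|Im w| ≤ Re w`. Hence the Mellin transform is its leading term up to a
factor `1 + δ` with `|δ| ≤ 0.4`, so that `R` vanishes only where `sin (πs/2)` does.
-/

theorem abs_im_le_norm_sin (z : ℂ) : |z.im| ≤ ‖sin z‖ := by
  calc |z.im| ≤ |Real.sinh z.im| := by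
        rw [Real.abs_sinh]
        exact Real.self_le_sinh_iff.mpr (abs_nonneg _)
    _ = |‖exp (-z * I)‖ - ‖exp (z * I)‖| / 2 := by
        simp [norm_exp, Real.sinh_eq, abs_div]
    _ ≤ ‖exp (-z * I) - exp (z * I)‖ / 2 := by
        gcongr
        exact abs_norm_sub_norm_le _ _
    _ = ‖sin z‖ := by simp [sin]

theorem exp_mul_I_mul_cpow {θ : ℝ} {z : ℂ} (hz : z ≠ 0) (hθ : θ + z.arg ∈ Ioc (-π) π) (s : ℂ) :
    (exp (θ * I) * z) ^ s = exp (θ * I * s) * z ^ s := by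
  have him : (θ * I + log z).im = θ + z.arg := by simp [log_im]
  have hlog : log (exp (θ * I) * z) = θ * I + log z := by
    nth_rewrite 1 [← exp_log hz]
    rw [← exp_add, log_exp (him ▸ hθ.1) (him ▸ hθ.2)]
  rw [cpow_def_of_ne_zero (mul_ne_zero (exp_ne_zero _) hz), hlog, cpow_def_of_ne_zero hz,
    add_mul, exp_add]

theorem exists_norm_cpow_le_mul_exp (s : ℂ) :
    ∃ C : ℝ, ∀ z : ℂ, 1 ≤ ‖z‖ → ‖z ^ s‖ ≤ C * Real.exp ‖z‖ := by
  obtain ⟨n, hn⟩ := exists_nat_ge s.re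
  refine ⟨n.factorial * Real.exp (π * |s.im|), fun z hz => ?_⟩
  have harg : -(z.arg * s.im) ≤ π * |s.im| := by
    refine (neg_le_abs _).trans ?_
    rw [abs_mul]
    gcongr
    exact abs_arg_le_pi z
  have hpow : ‖z‖ ^ s.re ≤ n.factorial * Real.exp ‖z‖ := by
    calc ‖z‖ ^ s.re ≤ ‖z‖ ^ (n : ℝ) := Real.rpow_le_rpow_of_exponent_le hz hn
      _ = ‖z‖ ^ n := Real.rpow_natCast _ _
      _ ≤ n.factorial * Real.exp ‖z‖ := by
        rw [← div_le_iff₀' (by positivity)]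
        exact Real.pow_div_factorial_le_exp _ (norm_nonneg z) n
  calc ‖z ^ s‖ ≤ ‖z‖ ^ s.re * Real.exp (-(z.arg * s.im)) := by
        rw [Real.exp_neg, ← div_eq_mul_inv]
        exact norm_cpow_le z s
    _ ≤ n.factorial * Real.exp ‖z‖ * Real.exp (π * |s.im|) := by gcongr
    _ = n.factorial * Real.exp (π * |s.im|) * Real.exp ‖z‖ := by ring

section ContourShift

variable {E : Type*} [NormedAddCommGroup E]

theorem integrable_of_isBigO_exp_neg_abs {f : ℝ → E} (hf : Continuous f)
    (hO : f =O[cocompact ℝ] fun x => Real.exp (-|x|)) : Integrable f := by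
  rw [cocompact_eq_atBot_atTop, Asymptotics.isBigO_sup] at hO
  refine hf.locallyIntegrable.integrable_of_isBigO_atBot_atTop
    (hO.1.congr' .rfl ?_) ⟨Iic 0, Iic_mem_atBot 0, integrableOn_exp_Iic 0⟩
    (hO.2.congr' .rfl ?_) ⟨Ioi 0, Ioi_mem_atTop 0, exp_neg_integrableOn_Ioi 0 one_pos⟩
  · filter_upwards [eventually_le_atBot 0] with x hx
    rw [abs_of_nonpos hx, neg_neg]
  · filter_upwards [eventually_ge_atTop 0] with x hx
    rw [abs_of_nonneg hx, neg_one_mul]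

variable [NormedSpace ℂ E]

theorem tendsto_intervalIntegral_vertical {f : ℂ → E} {a b : ℝ}
    (hf : Tendsto f (comap re (cocompact ℝ) ⊓ 𝓟 (im ⁻¹' [[a, b]])) (𝓝 0))
    {ι : Type*} {l : Filter ι} {T : ι → ℝ} (hT : Tendsto T l (cocompact ℝ)) :
    Tendsto (fun i => ∫ y in a..b, f (T i + y * I)) l (𝓝 0) := by
  rw [Metric.tendsto_nhds]
  intro ε hε
  have hδ : 0 < ε / (|b - a| + 1) := by positivity
  have hev := (hf.eventually (Metric.ball_mem_nhds 0 hδ))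
  rw [eventually_inf_principal, eventually_comap] at hev
  filter_upwards [hT.eventually hev] with i hi
  rw [dist_zero_right]
  calc ‖∫ y in a..b, f (T i + y * I)‖ ≤ ε / (|b - a| + 1) * |b - a| := by
        refine intervalIntegral.norm_integral_le_of_norm_le_const fun y hy => ?_
        have := hi (T i + y * I) (by simp) (by simpa using uIoc_subset_uIcc hy)
        exact (mem_ball_zero_iff.mp this).le
    _ < ε / (|b - a| + 1) * (|b - a| + 1) := by gcongr; linarith
    _ = ε := div_mul_cancel₀ _ (by positivity)

theorem integral_horizontal_eq_integral_horizontal {f : ℂ → E} {a b : ℝ}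
    (hcont : ContinuousOn f (im ⁻¹' [[a, b]]))
    (hdiff : DifferentiableOn ℂ f (im ⁻¹' Ioo (min a b) (max a b)))
    (hf : Tendsto f (comap re (cocompact ℝ) ⊓ 𝓟 (im ⁻¹' [[a, b]])) (𝓝 0))
    (ha : Integrable fun x : ℝ => f (x + a * I)) (hb : Integrable fun x : ℝ => f (x + b * I)) :
    ∫ x : ℝ, f (x + a * I) = ∫ x : ℝ, f (x + b * I) := by
  have hrect (T : ℝ) : (∫ x in -T..T, f (x + a * I)) - (∫ x in -T..T, f (x + b * I)) +
      I • (∫ y in a..b, f (T + y * I)) - I • (∫ y in a..b, f ((-T : ℝ) + y * I)) = 0 :=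
    integral_boundary_rect_eq_zero_of_continuousOn_of_differentiableOn f ⟨-T, a⟩ ⟨T, b⟩
      (hcont.mono fun _ hz => hz.2) (hdiff.mono fun _ hz => hz.2)
  have hedge {c : ℝ} (hc : Integrable fun x : ℝ => f (x + c * I)) :
      Tendsto (fun T : ℝ => ∫ x in -T..T, f (x + c * I)) atTop (𝓝 (∫ x : ℝ, f (x + c * I))) :=
    intervalIntegral_tendsto_integral hc tendsto_neg_atTop_atBot tendsto_id
  have hright := tendsto_intervalIntegral_vertical hf
    (tendsto_id.mono_right atTop_le_cocompact : Tendsto id atTop (cocompact ℝ))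
  have hleft := tendsto_intervalIntegral_vertical hf
    (tendsto_neg_atTop_atBot.mono_right atBot_le_cocompact : Tendsto Neg.neg atTop (cocompact ℝ))
  have hlim := (((hedge ha).sub (hedge hb)).add (hright.const_smul I)).sub (hleft.const_smul I)
  simp only [smul_zero, add_zero, sub_zero] at hlim
  exact sub_eq_zero.mp (tendsto_nhds_unique (hlim.congr hrect) tendsto_const_nhds)

end ContourShift

/-- The primitive eighth root of unity `e^{πi/4}`, the direction of the line of integration. -/
def ω : ℂ := exp (π * I / 4)

theorem ω_eq_exp_mul_I : ω = exp ((π / 4 : ℝ) * I) := by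
  rw [ω]
  push_cast
  ring_nf

theorem ω_re : ω.re = √2 / 2 := by
  rw [ω_eq_exp_mul_I, exp_ofReal_mul_I_re, Real.cos_pi_div_four]

theorem ω_im : ω.im = √2 / 2 := by
  rw [ω_eq_exp_mul_I, exp_ofReal_mul_I_im, Real.sin_pi_div_four]

theorem norm_ω : ‖ω‖ = 1 := by
  rw [ω_eq_exp_mul_I, norm_exp_ofReal_mul_I]

theorem ω_sq : ω ^ 2 = I := by
  rw [ω, ← exp_nat_mul]
  refine Eq.trans (congrArg exp ?_) exp_pi_div_two_mul_I
  push_cast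
  ring

theorem ω_mul_re (z : ℂ) : (ω * z).re = √2 / 2 * (z.re - z.im) := by
  rw [mul_re, ω_re, ω_im]; ring

theorem ω_mul_im (z : ℂ) : (ω * z).im = √2 / 2 * (z.re + z.im) := by
  rw [mul_im, ω_re, ω_im]; ring

theorem integrand_eq (s x : ℂ) :
    integrand s x = x ^ (-s) * exp (π * I * x ^ 2) / (2 * I * sin (π * x)) := by
  have hsin : 2 * I * sin (π * x) = exp (π * I * x) - exp (-(π * I * x)) := by
    rw [sin, show -(π * x) * I = -(π * I * x) by ring, show π * x * I = π * I * x by ring]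
    linear_combination (exp (-(π * I * x)) - exp (π * I * x)) * I_sq
  rw [integrand, hsin]

theorem integrand_ω_mul (s z : ℂ) :
    integrand s (ω * z) =
      (ω * z) ^ (-s) * exp (-(π * z ^ 2)) / (2 * I * sin (π * (ω * z))) := by
  rw [integrand_eq, mul_pow, ω_sq]
  congr 3
  linear_combination (π * z ^ 2 : ℂ) * I_sq

theorem continuousAt_integrand_zero {s : ℂ} (hs : s.re < -1) : ContinuousAt (integrand s) 0 := by
  have hpow : 0 < (-s - 1).re := by simpa using by linarith
  have hderiv : HasDerivAt (fun x : ℂ => sin (π * x)) π 0 := by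
    simpa using ((hasDerivAt_id (0 : ℂ)).const_mul (π : ℂ)).csin
  let q : ℂ → ℂ := dslope (fun x => sin (π * x)) 0
  have hq_zero : q 0 = π := by rw [← hderiv.deriv]; exact dslope_same _ _
  have hq (x : ℂ) : x * q x = sin (π * x) := by
    simpa [q] using sub_smul_dslope (fun x : ℂ => sin (π * x)) 0 x
  have heq : integrand s = fun x => x ^ (-s - 1) * exp (π * I * x ^ 2) / (2 * I * q x) := by
    funext x
    rcases eq_or_ne x 0 with rfl | hx
    · have : -s - 1 ≠ 0 := fun h => by simp [h] at hpow
      simp [integrand, zero_cpow this]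
    · rw [integrand_eq, ← hq, cpow_sub _ _ hx, cpow_one, div_mul_eq_mul_div, div_div]
      ring
  rw [heq]
  refine ContinuousAt.div ?_ ?_ (by simp [hq_zero, Real.pi_ne_zero])
  · exact (continuousAt_cpow_const_of_re_pos (by simp) hpow).mul (by fun_prop)
  · exact continuousAt_const.mul (continuousAt_dslope_same.mpr hderiv.differentiableAt)

theorem differentiableAt_integrand {s x : ℂ} (hslit : x ∈ slitPlane) (hx : ∀ n : ℤ, x ≠ n) :
    DifferentiableAt ℂ (integrand s) x := by
  have hsin : sin (π * x) ≠ 0 := by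
    rw [Ne, sin_eq_zero_iff]
    rintro ⟨n, hn⟩
    refine hx n (mul_right_cancel₀ (ofReal_ne_zero.mpr Real.pi_ne_zero) ?_)
    rw [← hn, mul_comm]
  rw [funext (integrand_eq s)]
  exact ((DifferentiableAt.cpow (by fun_prop) (by fun_prop) hslit).mul (by fun_prop)).div
    (by fun_prop) (mul_ne_zero (by simp) hsin)

/-- The closed strip which the rotation by `ω` maps onto the strip between the line of slope one
through `1 / 2` and its parallel through `0`. -/
def strip : Set ℂ := im ⁻¹' [[-(√2 / 4), 0]]

theorem mem_strip {z : ℂ} : z ∈ strip ↔ -(√2 / 4) ≤ z.im ∧ z.im ≤ 0 := by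
  have : 0 ≤ √2 / 4 := by positivity
  rw [strip, mem_preimage, uIcc_of_le (by linarith), mem_Icc]

theorem abs_im_le_of_mem_strip {z : ℂ} (hz : z ∈ strip) : |z.im| ≤ 2 / 5 := by
  have h2 : √2 < 1.5 := by rw [Real.sqrt_lt' (by norm_num)]; norm_num
  obtain ⟨hl, hu⟩ := mem_strip.mp hz
  rw [abs_le]
  constructor <;> linarith

theorem re_ω_mul_mem_Ioo_of_mem_strip {z : ℂ} (hz : z ∈ strip) (hz0 : z ≠ 0)
    (him : (ω * z).im = 0) : (ω * z).re ∈ Ioo 0 1 := by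
  have h2 : √2 ^ 2 = 2 := Real.sq_sqrt (by norm_num)
  have h2pos : 0 < √2 := by positivity
  obtain ⟨hl, hu⟩ := mem_strip.mp hz
  have hsum : z.re + z.im = 0 := by
    rw [ω_mul_im] at him
    exact (mul_eq_zero.mp him).resolve_left (by positivity)
  have hre : (ω * z).re = -(√2 * z.im) := by
    rw [ω_mul_re]
    linear_combination (√2 / 2) * hsum
  have hne : z.im ≠ 0 := fun h => hz0 (Complex.ext (by simpa [h] using hsum) h)
  have hlt : z.im < 0 := lt_of_le_of_ne hu hne
  rw [hre]
  constructor <;> nlinarith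

theorem differentiableAt_integrand_ω_mul {s z : ℂ} (hz : z ∈ strip) (hz0 : z ≠ 0) :
    DifferentiableAt ℂ (fun z => integrand s (ω * z)) z := by
  have hre := re_ω_mul_mem_Ioo_of_mem_strip hz hz0
  refine DifferentiableAt.comp z (differentiableAt_integrand ?_ fun n hn => ?_) (by fun_prop)
  · rw [mem_slitPlane_iff]
    exact or_iff_not_imp_right.mpr fun him => (hre (not_not.mp him)).1
  · rw [hn] at hre
    have h : (0 : ℝ) < n ∧ (n : ℝ) < 1 := hre (intCast_im n)
    norm_cast at h
    omega

theorem continuousOn_integrand_ω_mul {s : ℂ} (hs : s.re < -1) :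
    ContinuousOn (fun z => integrand s (ω * z)) strip := by
  intro z hz
  rcases eq_or_ne z 0 with rfl | hz0
  · have h0 : ContinuousAt (integrand s) (ω * 0) := by
      rw [mul_zero]
      exact continuousAt_integrand_zero hs
    exact (ContinuousAt.comp (f := fun z => ω * z) h0 (by fun_prop)).continuousWithinAt
  · exact (differentiableAt_integrand_ω_mul hz hz0).continuousAt.continuousWithinAt

theorem one_le_norm_two_mul_I_mul_sin {z : ℂ} (hz : z ∈ strip) (hre : 1 ≤ |z.re|) :
    1 ≤ ‖2 * I * sin (π * (ω * z))‖ := by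
  have h2 : 1.4 < √2 := Real.lt_sqrt_of_sq_lt (by norm_num)
  have hsum : 3 / 5 ≤ |z.re + z.im| := by
    have := abs_sub_abs_le_abs_add z.re z.im
    have := abs_im_le_of_mem_strip hz
    linarith
  calc (1 : ℝ) ≤ 2 * (3 * (1.4 / 2 * (3 / 5))) := by norm_num
    _ ≤ 2 * (π * (√2 / 2 * |z.re + z.im|)) := by gcongr; exact Real.pi_gt_three.le
    _ = 2 * |(π * (ω * z)).im| := by
        rw [im_ofReal_mul, ω_mul_im, abs_mul, abs_mul, abs_of_pos Real.pi_pos,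
          abs_of_nonneg (by positivity : 0 ≤ √2 / 2)]
    _ ≤ 2 * ‖sin (π * (ω * z))‖ := by gcongr; exact abs_im_le_norm_sin _
    _ = ‖2 * I * sin (π * (ω * z))‖ := by simp

theorem isBigO_integrand_ω_mul (s : ℂ) :
    (fun z => integrand s (ω * z)) =O[comap re (cocompact ℝ) ⊓ 𝓟 strip]
      fun z => Real.exp (-|z.re|) := by
  obtain ⟨C, hC⟩ := exists_norm_cpow_le_mul_exp (-s)
  have hlarge : ∀ᶠ z in comap re (cocompact ℝ), 1 ≤ |z.re| :=
    (tendsto_comap (f := re) (x := cocompact ℝ)).eventually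
      ((tendsto_norm_cocompact_atTop (E := ℝ)).eventually_ge_atTop 1)
  refine Asymptotics.IsBigO.of_bound (C * Real.exp 2) (eventually_inf_principal.mpr ?_)
  filter_upwards [hlarge] with z hre hz
  have him := abs_im_le_of_mem_strip hz
  have hnorm : ‖ω * z‖ = ‖z‖ := by rw [norm_mul, norm_ω, one_mul]
  have hpow : ‖(ω * z) ^ (-s)‖ ≤ C * Real.exp ‖z‖ :=
    hnorm ▸ hC (ω * z) (hnorm ▸ hre.trans (abs_re_le_norm z))
  have hC0 : 0 ≤ C := nonneg_of_mul_nonneg_left ((norm_nonneg _).trans hpow) (Real.exp_pos _)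
  have hexp : ‖exp (-(π * z ^ 2))‖ = Real.exp (-(π * (|z.re| ^ 2 - |z.im| ^ 2))) := by
    rw [norm_exp, neg_re, re_ofReal_mul, sq_abs, sq_abs, sq z, mul_re, sq, sq]
  have hexponent : ‖z‖ - π * (|z.re| ^ 2 - |z.im| ^ 2) ≤ 2 - |z.re| := by
    have := norm_le_abs_re_add_abs_im z
    nlinarith [Real.pi_gt_three, Real.pi_lt_d2, abs_nonneg z.im]
  calc ‖integrand s (ω * z)‖
      ≤ ‖(ω * z) ^ (-s)‖ * ‖exp (-(π * z ^ 2))‖ := by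
        rw [integrand_ω_mul, norm_div, norm_mul]
        exact div_le_self (by positivity) (one_le_norm_two_mul_I_mul_sin hz hre)
    _ ≤ C * Real.exp ‖z‖ * Real.exp (-(π * (|z.re| ^ 2 - |z.im| ^ 2))) := by
        rw [hexp]
        gcongr
    _ = C * Real.exp (‖z‖ - π * (|z.re| ^ 2 - |z.im| ^ 2)) := by
        rw [mul_assoc, ← Real.exp_add, ← sub_eq_add_neg]
    _ ≤ C * Real.exp (2 - |z.re|) := by gcongr
    _ = C * Real.exp 2 * ‖Real.exp (-|z.re|)‖ := by
        rw [sub_eq_add_neg, Real.exp_add, Real.norm_of_nonneg (Real.exp_pos _).le, mul_assoc]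

theorem integrable_integrand_ω_mul {s : ℂ} (hs : s.re < -1) {y : ℝ}
    (hy : y ∈ [[-(√2 / 4), 0]]) : Integrable fun r : ℝ => integrand s (ω * (r + y * I)) := by
  have hre (r : ℝ) : (r + y * I : ℂ).re = r := by simp
  have him (r : ℝ) : (r + y * I : ℂ).im = y := by simp
  have hline : Tendsto (fun r : ℝ => (r + y * I : ℂ)) (cocompact ℝ)
      (comap re (cocompact ℝ) ⊓ 𝓟 strip) := by
    refine tendsto_inf.mpr ⟨tendsto_comap_iff.mpr ?_, tendsto_principal.mpr (.of_forall ?_)⟩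
    · simp only [Function.comp_def, hre]
      exact tendsto_id
    · simpa only [strip, mem_preimage, him] using fun _ => hy
  refine integrable_of_isBigO_exp_neg_abs ?_ ?_
  · refine (continuousOn_integrand_ω_mul hs).comp_continuous (by fun_prop) fun r => ?_
    simpa only [strip, mem_preimage, him] using hy
  · simpa only [Function.comp_def, hre] using (isBigO_integrand_ω_mul s).comp_tendsto hline

theorem auxR_eq_integral_integrand_ω_mul {s : ℂ} (hs : s.re < -1) :
    auxR s = -(ω * ∫ r : ℝ, integrand s (ω * r)) := by
  have h2 : (√2 : ℂ) ^ 2 = 2 := by exact_mod_cast Real.sq_sqrt (zero_le_two : (0 : ℝ) ≤ 2)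
  have hω : ω = √2 / 2 + √2 / 2 * I := by
    apply Complex.ext <;> simp [ω_re, ω_im, ← ofReal_ofNat, ← ofReal_div]
  have hpath (r : ℝ) : path r = ω * ((r + √2 / 4 : ℝ) + (-(√2 / 4) : ℝ) * I) := by
    rw [path, ← ω, hω]
    push_cast
    linear_combination (-1 / 4 : ℂ) * h2 + (1 / 8 : ℂ) * (√2 : ℂ) ^ 2 * I_sq
  have hdecay : Tendsto (fun z : ℂ => Real.exp (-|z.re|)) (comap re (cocompact ℝ)) (𝓝 0) :=
    Real.tendsto_exp_neg_atTop_nhds_zero.comp (tendsto_norm_cocompact_atTop.comp tendsto_comap)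
  have hdiff : DifferentiableOn ℂ (fun z => integrand s (ω * z))
      (im ⁻¹' Ioo (min (-(√2 / 4)) 0) (max (-(√2 / 4)) 0)) := by
    refine fun z hz => (differentiableAt_integrand_ω_mul (Ioo_subset_Icc_self hz) ?_)
      |>.differentiableWithinAt
    rintro rfl
    simp only [mem_preimage, zero_im, mem_Ioo, min_lt_iff, lt_max_iff, lt_self_iff_false,
      or_false] at hz
    linarith
  have hshift := integral_horizontal_eq_integral_horizontal (continuousOn_integrand_ω_mul hs)
    hdiff
    ((isBigO_integrand_ω_mul s).trans_tendsto (hdecay.mono_left inf_le_left))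
    (integrable_integrand_ω_mul hs left_mem_uIcc) (integrable_integrand_ω_mul hs right_mem_uIcc)
  rw [auxR, ← ω, integral_mul_const, mul_comm]
  simp only [hpath]
  rw [integral_add_right_eq_self (fun r : ℝ => integrand s (ω * (r + (-(√2 / 4) : ℝ) * I))),
    hshift]
  simp only [ofReal_zero, zero_mul, add_zero]

/-- The integrand on the ray from `0` in the direction `ω`, without the power of the variable and
the constant factors. -/
def kern (y : ℝ) : ℂ := exp (-(π * (y : ℂ) ^ 2)) / sin (π * (ω * y))

theorem integrand_ω_mul_ofReal (s : ℂ) {y : ℝ} (hy : 0 < y) :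
    integrand s (ω * y) = exp (-(π * I * s / 4)) / (2 * I) * ((y : ℂ) ^ (-s) * kern y) := by
  have hpow : (ω * y) ^ (-s) = exp (-(π * I * s / 4)) * (y : ℂ) ^ (-s) := by
    rw [ω_eq_exp_mul_I, exp_mul_I_mul_cpow (ofReal_ne_zero.mpr hy.ne')]
    · push_cast
      ring_nf
    · rw [arg_ofReal_of_nonneg hy.le]
      constructor <;> linarith [Real.pi_pos]
  rw [integrand_ω_mul, hpow, kern]
  ring

theorem integrand_ω_mul_neg_ofReal (s : ℂ) {y : ℝ} (hy : 0 < y) :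
    integrand s (ω * -y) = -(exp (3 * π * I * s / 4) / (2 * I)) * ((y : ℂ) ^ (-s) * kern y) := by
  have hrot : ω * -y = exp ((-(3 * π / 4) : ℝ) * I) * y := by
    rw [ω, show (π * I / 4 : ℂ) = (-(3 * π / 4) : ℝ) * I + π * I by push_cast; ring,
      exp_add, exp_pi_mul_I]
    ring
  have hpow : (ω * -y) ^ (-s) = exp (3 * π * I * s / 4) * (y : ℂ) ^ (-s) := by
    rw [hrot, exp_mul_I_mul_cpow (ofReal_ne_zero.mpr hy.ne')]
    · push_cast
      ring_nf
    · rw [arg_ofReal_of_nonneg hy.le]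
      constructor <;> linarith [Real.pi_pos]
  rw [integrand_ω_mul, hpow, kern, mul_neg, mul_neg, sin_neg, neg_sq]
  ring

theorem auxR_eq_mellin_kern {s : ℂ} (hs : s.re < -1) :
    auxR s = exp (π * I * (s + 1) / 4) * sin (π * s / 2) * mellin kern (1 - s) := by
  have hmellin : mellin kern (1 - s) = ∫ y : ℝ in Ioi 0, (y : ℂ) ^ (-s) * kern y := by
    simp only [mellin, smul_eq_mul, show 1 - s - 1 = -s by ring]
  have hpos : ∫ r : ℝ in Ioi 0, integrand s (ω * r) =
      exp (-(π * I * s / 4)) / (2 * I) * mellin kern (1 - s) := by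
    rw [hmellin, ← integral_const_mul]
    exact setIntegral_congr_fun measurableSet_Ioi fun y hy => integrand_ω_mul_ofReal s hy
  have hneg : ∫ r : ℝ in Iic 0, integrand s (ω * r) =
      -(exp (3 * π * I * s / 4) / (2 * I)) * mellin kern (1 - s) := by
    rw [← neg_zero, ← integral_comp_neg_Ioi 0 fun r : ℝ => integrand s (ω * r), hmellin,
      ← integral_const_mul]
    refine setIntegral_congr_fun measurableSet_Ioi fun y hy => ?_
    simpa only [ofReal_neg] using integrand_ω_mul_neg_ofReal s hy
  have hint : Integrable fun r : ℝ => integrand s (ω * r) := by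
    simpa only [ofReal_zero, zero_mul, add_zero] using
      integrable_integrand_ω_mul hs (right_mem_uIcc (a := -(√2 / 4)) (b := 0))
  have hconst : -(ω * (-(exp (3 * π * I * s / 4) / (2 * I)) + exp (-(π * I * s / 4)) / (2 * I))) =
      exp (π * I * (s + 1) / 4) * sin (π * s / 2) := by
    rw [sin, ω, show (π * I * (s + 1) / 4 : ℂ) = π * I / 4 + π * I * s / 4 by ring,
      show (3 * π * I * s / 4 : ℂ) = π * I * s / 4 + π * s / 2 * I by ring,
      show (-(π * I * s / 4) : ℂ) = π * I * s / 4 + -(π * s / 2) * I by ring]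
    simp only [exp_add]
    field_simp
    linear_combination (exp (π * I * s / 2) - exp (-(π * I * s / 2))) * I_sq
  rw [auxR_eq_integral_integrand_ω_mul hs, ← hconst,
    ← intervalIntegral.integral_Iic_add_Ioi hint.integrableOn hint.integrableOn, hneg, hpos]
  ring

section Mellin

theorem integrableOn_rpow_mul_exp_neg_mul {a b : ℝ} (ha : 0 < a) (hb : 0 < b) :
    IntegrableOn (fun y : ℝ => y ^ (a - 1) * Real.exp (-(b * y))) (Ioi 0) := by
  simpa using integrableOn_rpow_mul_exp_neg_mul_rpow (p := 1) (s := a - 1) (by linarith) one_pos hb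

theorem norm_exp_neg_mul_ofReal (p : ℂ) (y : ℝ) :
    ‖exp (-(p * y))‖ = Real.exp (-(p.re * y)) := by
  rw [norm_exp, neg_re, re_mul_ofReal]

theorem mul_exp_neg_mul_le {a : ℝ} (ha : 0 < a) (y : ℝ) :
    Real.exp (-(2 * a * y)) * y ≤ a⁻¹ * Real.exp (-(a * y)) := by
  have hlin : y ≤ a⁻¹ * Real.exp (a * y) := by
    rw [← div_eq_inv_mul, le_div_iff₀ ha, mul_comm]
    linarith [Real.add_one_le_exp (a * y)]
  calc Real.exp (-(2 * a * y)) * y ≤ Real.exp (-(2 * a * y)) * (a⁻¹ * Real.exp (a * y)) := by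
        gcongr
    _ = a⁻¹ * Real.exp (-(a * y)) := by
        rw [mul_left_comm, ← Real.exp_add]
        ring_nf

theorem differentiableOn_integral_mul_exp_neg {f : ℝ → ℂ}
    (hf : ∀ b : ℝ, 0 < b → IntegrableOn (fun y => f y * exp (-(b * y))) (Ioi 0)) :
    DifferentiableOn ℂ (fun p : ℂ => ∫ y : ℝ in Ioi 0, f y * exp (-(p * y))) {p | 0 < p.re} := by
  have hmeas : AEStronglyMeasurable f (volume.restrict (Ioi 0)) := by
    have hexp : Continuous fun y : ℝ => exp y := by fun_prop
    refine ((hf 1 one_pos).aestronglyMeasurable.mul hexp.aestronglyMeasurable).congr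
      (.of_forall fun y => ?_)
    simp [mul_assoc, ← exp_add]
  have hint (p : ℂ) (hp : 0 < p.re) : IntegrableOn (fun y => f y * exp (-(p * y))) (Ioi 0) :=
    Integrable.mono (hf p.re hp) (hmeas.mul (by fun_prop)) (.of_forall fun y => by
      simp [norm_exp_neg_mul_ofReal])
  intro q (hq : 0 < q.re)
  have hball : ∀ p ∈ Metric.ball q (q.re / 2), q.re / 2 ≤ p.re := fun p hp => by
    have := (abs_re_le_norm (p - q)).trans_lt (mem_ball_iff_norm.mp hp)
    rw [sub_re, abs_lt] at this
    linarith [this.1]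
  refine (hasDerivAt_integral_of_dominated_loc_of_deriv_le
    (F := fun (p : ℂ) (y : ℝ) => f y * exp (-(p * y)))
    (F' := fun (p : ℂ) (y : ℝ) => f y * (exp (-(p * y)) * -(y : ℂ)))
    (bound := fun y : ℝ => (q.re / 4)⁻¹ * ‖f y * exp (-((q.re / 4 : ℝ) * y))‖)
    (Metric.ball_mem_nhds q (half_pos hq)) (.of_forall fun p => hmeas.mul (by fun_prop))
    (hint q hq) (hmeas.mul (by fun_prop)) ?_ ((hf _ (by positivity)).norm.const_mul _)
    ?_).2.differentiableAt.differentiableWithinAt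
  · refine (ae_restrict_mem measurableSet_Ioi).mono fun y (hy : 0 < y) p hp => ?_
    calc ‖f y * (exp (-(p * y)) * -(y : ℂ))‖ = ‖f y‖ * (Real.exp (-(p.re * y)) * y) := by
          simp [norm_exp_neg_mul_ofReal, abs_of_pos hy]
      _ ≤ ‖f y‖ * (Real.exp (-(2 * (q.re / 4) * y)) * y) := by
          have := hball p hp
          gcongr
          linarith
      _ ≤ ‖f y‖ * ((q.re / 4)⁻¹ * Real.exp (-(q.re / 4 * y))) := by
          gcongr ‖f y‖ * ?_
          exact mul_exp_neg_mul_le (by positivity) y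
      _ = (q.re / 4)⁻¹ * ‖f y * exp (-((q.re / 4 : ℝ) * y))‖ := by
          rw [norm_mul, norm_exp_neg_mul_ofReal, ofReal_re, mul_left_comm]
  · refine .of_forall fun y p _ => ((HasDerivAt.cexp ?_).const_mul _)
    exact (hasDerivAt_mul_const (y : ℂ)).fun_neg

variable {w : ℂ}

theorem norm_cpow_sub_one {y : ℝ} (hy : 0 < y) (w : ℂ) :
    ‖(y : ℂ) ^ (w - 1)‖ = y ^ (w.re - 1) := by
  rw [norm_cpow_eq_rpow_re_of_pos hy, sub_re, one_re]

theorem mellinConvergent_of_norm_le_exp {E : Type*} [NormedAddCommGroup E] [NormedSpace ℂ E]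
    {f : ℝ → E} {b : ℝ} (hf : Continuous f) (hb : 0 < b)
    (hle : ∀ y, 0 < y → ‖f y‖ ≤ Real.exp (-(b * y))) (hw : 0 < w.re) : MellinConvergent f w := by
  have hcpow : ContinuousOn (fun y : ℝ => (y : ℂ) ^ (w - 1)) (Ioi 0) := fun y hy =>
    (continuousAt_ofReal_cpow_const y _ (Or.inr (ne_of_gt hy))).continuousWithinAt
  refine (integrableOn_rpow_mul_exp_neg_mul hw hb).mono'
    ((hcpow.smul hf.continuousOn).aestronglyMeasurable measurableSet_Ioi)
    ((ae_restrict_mem measurableSet_Ioi).mono fun y (hy : 0 < y) => ?_)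
  rw [norm_smul, norm_cpow_sub_one hy]
  gcongr
  exact hle y hy

theorem mellin_exp_neg_mul (hw : 0 < w.re) {p : ℂ} (hp : 0 < p.re) :
    mellin (fun y : ℝ => exp (-(p * y))) w = Gamma w * p ^ (-w) := by
  have hopen : IsOpen {p : ℂ | 0 < p.re} := isOpen_lt continuous_const continuous_re
  have hlaplace : DifferentiableOn ℂ (fun p : ℂ => mellin (fun y : ℝ => exp (-(p * y))) w)
      {p | 0 < p.re} := by
    refine differentiableOn_integral_mul_exp_neg fun b hb => ?_
    refine mellinConvergent_of_norm_le_exp (f := fun y : ℝ => exp (-(b * y))) (by fun_prop) hb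
      (fun y _ => le_of_eq ?_) hw
    rw [norm_exp_neg_mul_ofReal, ofReal_re]
  have hpower : DifferentiableOn ℂ (fun p : ℂ => Gamma w * p ^ (-w)) {p | 0 < p.re} := fun q hq =>
    ((differentiableAt_id.cpow_const (Or.inl hq)).const_mul _).differentiableWithinAt
  have hreal : ∀ᶠ r : ℝ in 𝓝[≠] 1, mellin (fun y : ℝ => exp (-(r * y))) w = Gamma w * r ^ (-w) := by
    filter_upwards [mem_nhdsWithin_of_mem_nhds (lt_mem_nhds one_pos)] with r (hr : 0 < r)
    have harg : (r : ℂ).arg ≠ π := by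
      rw [arg_ofReal_of_nonneg hr.le]
      exact Real.pi_ne_zero.symm
    simp only [mellin, smul_eq_mul]
    rw [integral_cpow_mul_exp_neg_mul_Ioi hw hr, one_div, inv_cpow _ _ harg, cpow_neg, mul_comm]
  have hmap : Tendsto (fun r : ℝ => (r : ℂ)) (𝓝[≠] 1) (𝓝[≠] 1) :=
    ofReal_one ▸ continuous_ofReal.continuousWithinAt.tendsto_nhdsWithin fun r hr h =>
      hr (ofReal_injective (h.trans ofReal_one.symm))
  exact (hlaplace.analyticOnNhd hopen).eqOn_of_preconnected_of_frequently_eq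
    (hpower.analyticOnNhd hopen) (convex_halfSpace_re_gt 0).isPreconnected (z₀ := 1) (by simp)
    (hmap.frequently hreal.frequently) hp

theorem mellin_integral_mul_exp_neg_mul {X : Type*} [MeasurableSpace X] {μ : Measure X} [SFinite μ]
    {φ p : X → ℂ} {b : ℝ} (hφ : Integrable φ μ) (hp : AEStronglyMeasurable p μ) (hb : 0 < b)
    (hpb : ∀ x, b ≤ (p x).re) (hw : 0 < w.re) :
    mellin (fun y : ℝ => ∫ x, φ x * exp (-(p x * y)) ∂μ) w =
      Gamma w * ∫ x, φ x * p x ^ (-w) ∂μ := by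
  have hint : Integrable
      (Function.uncurry fun (x : X) (y : ℝ) => φ x * ((y : ℂ) ^ (w - 1) * exp (-(p x * y))))
      (μ.prod (volume.restrict (Ioi 0))) := by
    have hmeas : AEStronglyMeasurable (fun z : X × ℝ => (z.2 : ℂ) ^ (w - 1))
        (μ.prod (volume.restrict (Ioi 0))) := by
      exact ((measurable_ofReal.comp measurable_snd).pow_const _).aestronglyMeasurable
    refine (hφ.norm.mul_prod (integrableOn_rpow_mul_exp_neg_mul hw hb)).mono'
      (hφ.1.comp_fst.mul (hmeas.mul ?_)) ?_
    · exact continuous_exp.comp_aestronglyMeasurable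
        (hp.comp_fst.mul (measurable_ofReal.comp measurable_snd).aestronglyMeasurable).neg
    · filter_upwards [Measure.quasiMeasurePreserving_snd.ae (ae_restrict_mem measurableSet_Ioi)]
        with ⟨x, y⟩ (hy : 0 < y)
      rw [Function.uncurry_apply_pair, norm_mul, norm_mul, norm_cpow_sub_one hy,
        norm_exp_neg_mul_ofReal]
      gcongr
      exact hpb x
  calc mellin (fun y : ℝ => ∫ x, φ x * exp (-(p x * y)) ∂μ) w
      = ∫ y : ℝ in Ioi 0, ∫ x, φ x * ((y : ℂ) ^ (w - 1) * exp (-(p x * y))) ∂μ := by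
        simp only [mellin, smul_eq_mul, ← integral_const_mul, mul_left_comm]
    _ = ∫ x, φ x * mellin (fun y : ℝ => exp (-(p x * y))) w ∂μ := by
        rw [← integral_integral_swap hint]
        simp only [mellin, smul_eq_mul, integral_const_mul]
    _ = Gamma w * ∫ x, φ x * p x ^ (-w) ∂μ := by
        simp only [fun x => mellin_exp_neg_mul hw (hb.trans_le (hpb x)), ← integral_const_mul]
        congr with x
        ring

theorem hasSum_mellin_of_norm_le_exp {ι : Type*} [Countable ι] {E : Type*}
    [NormedAddCommGroup E] [NormedSpace ℂ E] {f : ι → ℝ → E} {F : ℝ → E} {b : ι → ℝ}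
    (hf : ∀ i, Continuous (f i)) (hb : ∀ i, 0 < b i)
    (hle : ∀ i y, 0 < y → ‖f i y‖ ≤ Real.exp (-(b i * y))) (hw : 0 < w.re)
    (hsum : Summable fun i => (1 / b i) ^ w.re) (hF : ∀ y, 0 < y → HasSum (f · y) (F y)) :
    HasSum (fun i => mellin (f i) w) (mellin F w) := by
  have hint (i : ι) : MellinConvergent (f i) w :=
    mellinConvergent_of_norm_le_exp (hf i) (hb i) (hle i) hw
  have hnorm (i : ι) : ∫ y : ℝ in Ioi 0, ‖(y : ℂ) ^ (w - 1) • f i y‖ ≤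
      (1 / b i) ^ w.re * Real.Gamma w.re := by
    rw [← Real.integral_rpow_mul_exp_neg_mul_Ioi hw (hb i)]
    refine setIntegral_mono_on (hint i).norm (integrableOn_rpow_mul_exp_neg_mul hw (hb i))
      measurableSet_Ioi fun y (hy : 0 < y) => ?_
    rw [norm_smul, norm_cpow_sub_one hy]
    gcongr
    exact hle i y hy
  have hmellin : mellin F w = ∫ y : ℝ in Ioi 0, ∑' i, (y : ℂ) ^ (w - 1) • f i y :=
    setIntegral_congr_fun measurableSet_Ioi fun y hy =>
      ((hF y hy).const_smul ((y : ℂ) ^ (w - 1))).tsum_eq.symm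
  rw [hmellin]
  exact hasSum_integral_of_summable_integral_norm hint ((hsum.mul_right _).of_nonneg_of_le
    (fun i => integral_nonneg fun y => norm_nonneg _) hnorm)

end Mellin

section GaussianExpansion

theorem hasSum_exp_odd_mul_I {z : ℂ} (hz : 0 < z.im) :
    HasSum (fun k : ℕ => exp ((2 * k + 1) * (I * z))) (I / (2 * sin z)) := by
  set u := exp (I * z) with hu
  have hu0 : u ≠ 0 := exp_ne_zero _
  have hsq : ‖u ^ 2‖ < 1 := by
    rw [norm_pow, hu, norm_exp, I_mul_re]
    exact pow_lt_one₀ (Real.exp_nonneg _) (Real.exp_lt_one_iff.mpr (neg_neg_of_pos hz)) two_ne_zero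
  have hone : 1 - u ^ 2 ≠ 0 := sub_ne_zero.mpr fun h => by simp [← h] at hsq
  have hsin : sin z = (u⁻¹ - u) * I / 2 := by
    rw [sin, hu, ← exp_neg, mul_comm I, neg_mul]
  have hterm (k : ℕ) : exp ((2 * k + 1) * (I * z)) = u * (u ^ 2) ^ k := by
    rw [hu, ← exp_nat_mul, ← exp_nat_mul, ← exp_add]
    push_cast
    ring_nf
  have hsum : I / (2 * sin z) = u * (1 - u ^ 2)⁻¹ := by
    rw [hsin, show u⁻¹ - u = (1 - u ^ 2) * u⁻¹ by field_simp]
    field_simp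
  simp only [hterm, hsum]
  exact (hasSum_geometric_of_norm_lt_one hsq).mul_left u

/-- The Gaussian–Mellin integral `∫₀^∞ y^{w-1} e^{-πy²+2παy} dy`. The Mellin transform of `kern` is
a series of these. -/
def gaussMellin (w α : ℂ) : ℂ :=
  mellin (fun y : ℝ => exp (-(π * (y : ℂ) ^ 2) + 2 * π * α * y)) w

/-- The integral of `g^{-w} e^{π(g+α)²}` over the vertical line `g = c + ir`. It does not depend on
`c > 0`, see `vertGauss_eq_vertGauss`. -/
def vertGauss (c : ℝ) (w α : ℂ) : ℂ :=
  ∫ r : ℝ, (c + r * I : ℂ) ^ (-w) * exp (π * (c + r * I + α) ^ 2)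

theorem norm_exp_vert (c : ℝ) (α : ℂ) (r : ℝ) :
    ‖exp (π * (c + r * I + α) ^ 2)‖ =
      Real.exp (π * (c + α.re) ^ 2) * Real.exp (-π * (r + α.im) ^ 2) := by
  have hre : (π * (c + r * I + α) ^ 2 : ℂ).re = π * (c + α.re) ^ 2 + -π * (r + α.im) ^ 2 := by
    simp only [pow_two, mul_re, add_re, add_im, ofReal_re, ofReal_im, im_ofReal_mul, I_re, I_im]
    ring
  rw [norm_exp, hre, Real.exp_add]

theorem integrable_exp_vert (c : ℝ) (α : ℂ) :
    Integrable fun r : ℝ => exp (π * (c + r * I + α) ^ 2) := by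
  refine (integrable_cexp_quadratic (b := π) (by simpa using Real.pi_pos)
    (2 * π * I * (c + α)) (π * (c + α) ^ 2)).congr (.of_forall fun r => congrArg exp ?_)
  linear_combination (-(π * r ^ 2) : ℂ) * I_sq

theorem integral_exp_vert_mul_exp (c : ℝ) (α : ℂ) (y : ℝ) :
    ∫ r : ℝ, exp (π * (c + r * I + α) ^ 2) * exp (-(2 * π * (c + r * I) * y)) =
      exp (-(π * (y : ℂ) ^ 2) + 2 * π * α * y) := by
  have hpi : (π : ℂ) ≠ 0 := ofReal_ne_zero.mpr Real.pi_ne_zero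
  calc ∫ r : ℝ, exp (π * (c + r * I + α) ^ 2) * exp (-(2 * π * (c + r * I) * y))
      = ∫ r : ℝ, exp (-π * r ^ 2 + 2 * π * I * (c + α - y) * r +
          (π * (c + α) ^ 2 - 2 * π * c * y)) := by
        congr with r
        rw [← exp_add]
        congr 1
        linear_combination (π * r ^ 2 : ℂ) * I_sq
    _ = exp (-(π * (y : ℂ) ^ 2) + 2 * π * α * y) := by
        rw [integral_cexp_quadratic (by simpa using Real.pi_pos), neg_neg, div_self hpi, one_cpow,
          one_mul]
        congr 1
        field_simp
        rw [I_sq]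
        ring

variable {w : ℂ}

theorem gaussMellin_eq_vertGauss (hw : 0 < w.re) (α : ℂ) {c : ℝ} (hc : 0 < c) :
    gaussMellin w α = Gamma w * (2 * π : ℂ) ^ (-w) * vertGauss c w α := by
  have hsplit (r : ℝ) : (2 * π * (c + r * I) : ℂ) ^ (-w) =
      (2 * π : ℂ) ^ (-w) * (c + r * I : ℂ) ^ (-w) := by
    have hne : (c + r * I : ℂ) ≠ 0 := slitPlane_ne_zero (.inl (by simpa using hc))
    have hpi : (0 : ℝ) < 2 * π := by positivity
    have hpi' : (2 * π : ℂ) ≠ 0 := by exact_mod_cast hpi.ne'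
    rw [cpow_def_of_ne_zero (mul_ne_zero hpi' hne), cpow_def_of_ne_zero hpi',
      cpow_def_of_ne_zero hne, ← exp_add, ← add_mul]
    have hlog := log_ofReal_mul hpi hne
    push_cast [ofReal_log hpi.le] at hlog
    rw [hlog]
  have hre (r : ℝ) : (2 * π * (c + r * I) : ℂ).re = 2 * π * c := by simp
  calc gaussMellin w α = mellin (fun y : ℝ => ∫ r : ℝ, exp (π * (c + r * I + α) ^ 2) *
          exp (-(2 * π * (c + r * I) * y))) w := by
        simp only [gaussMellin, integral_exp_vert_mul_exp]
    _ = Gamma w * ∫ r : ℝ, exp (π * (c + r * I + α) ^ 2) * (2 * π * (c + r * I) : ℂ) ^ (-w) :=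
        mellin_integral_mul_exp_neg_mul (integrable_exp_vert c α)
          (Continuous.aestronglyMeasurable (by fun_prop)) (by positivity : 0 < 2 * π * c)
          (fun r => (hre r).ge) hw
    _ = Gamma w * (2 * π : ℂ) ^ (-w) * vertGauss c w α := by
        simp only [vertGauss, hsplit, ← integral_const_mul]
        congr with r
        ring

theorem vertGauss_eq_vertGauss (hw : 0 < w.re) (α : ℂ) {c c' : ℝ} (hc : 0 < c) (hc' : 0 < c') :
    vertGauss c w α = vertGauss c' w α := by
  have hpow : (2 * π : ℂ) ^ (-w) ≠ 0 := by simp [Real.pi_ne_zero]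
  refine mul_left_cancel₀ (mul_ne_zero (Gamma_ne_zero_of_re_pos hw) hpow) ?_
  rw [← gaussMellin_eq_vertGauss hw α hc, ← gaussMellin_eq_vertGauss hw α hc']

/-- The parameters `α = (2k+1)iω/2` of the Gaussian–Mellin integrals in the expansion of
`mellin kern`. -/
def shift (k : ℕ) : ℂ := (2 * k + 1) * (I * ω / 2)

theorem hasSum_exp_shift {y : ℝ} (hy : 0 < y) :
    HasSum (fun k => exp (-(π * (y : ℂ) ^ 2) + 2 * π * shift k * y)) (I / 2 * kern y) := by
  have him : 0 < (π * (ω * y)).im := by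
    rw [im_ofReal_mul, im_mul_ofReal, ω_im]
    positivity
  have hterm (k : ℕ) : exp (-(π * (y : ℂ) ^ 2) + 2 * π * shift k * y) =
      exp (-(π * (y : ℂ) ^ 2)) * exp ((2 * k + 1) * (I * (π * (ω * y)))) := by
    rw [shift, ← exp_add]
    ring_nf
  have hkern : I / 2 * kern y = exp (-(π * (y : ℂ) ^ 2)) * (I / (2 * sin (π * (ω * y)))) := by
    rw [kern]
    ring
  simp only [hterm, hkern]
  exact (hasSum_exp_odd_mul_I him).mul_left _

theorem norm_exp_shift_le (k : ℕ) {y : ℝ} (hy : 0 < y) :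
    ‖exp (-(π * (y : ℂ) ^ 2) + 2 * π * shift k * y)‖ ≤ Real.exp (-((k + 1 : ℕ) * y)) := by
  have hre : (-(π * (y : ℂ) ^ 2) + 2 * π * shift k * y).re =
      -(π * y ^ 2) - (2 * k + 1) * (π * (√2 / 2)) * y := by
    rw [shift, show (-(π * (y : ℂ) ^ 2) + 2 * π * ((2 * k + 1) * (I * ω / 2)) * y : ℂ) =
      (-(π * y ^ 2) : ℝ) + ((2 * k + 1) * π * y : ℝ) * (I * ω) by push_cast; ring, add_re,
      ofReal_re, re_ofReal_mul, I_mul_re, ω_im]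
    ring
  have hone : 1 ≤ π * (√2 / 2) := by
    nlinarith [Real.pi_gt_three, Real.one_le_sqrt.mpr (one_le_two (α := ℝ))]
  have hrate : (k + 1 : ℝ) ≤ (2 * k + 1) * (π * (√2 / 2)) := by
    nlinarith [k.cast_nonneg (α := ℝ)]
  rw [norm_exp, hre, Real.exp_le_exp]
  push_cast
  nlinarith [Real.pi_pos, sq_nonneg y, mul_le_mul_of_nonneg_right hrate hy.le]

theorem hasSum_gaussMellin (hw : 1 < w.re) :
    HasSum (fun k => gaussMellin w (shift k)) (I / 2 * mellin kern w) := by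
  rw [← smul_eq_mul, ← mellin_const_smul]
  refine hasSum_mellin_of_norm_le_exp (fun k => by fun_prop) (fun k => by positivity)
    (fun k y hy => norm_exp_shift_le k hy) (by linarith) ?_ fun y hy => hasSum_exp_shift hy
  simp only [one_div, Real.inv_rpow (Nat.cast_nonneg _)]
  exact (summable_nat_add_iff 1).mpr (Real.summable_nat_rpow_inv.mpr hw)

end GaussianExpansion

section RealGaussian

variable {β : ℝ}

theorem integrable_exp_neg_mul_sq_add_mul (hβ : 0 < β) (γ : ℝ) :
    Integrable fun r : ℝ => Real.exp (-β * r ^ 2 + γ * r) := by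
  refine (((integrable_exp_neg_mul_sq hβ).comp_sub_right (γ / (2 * β))).const_mul
    (Real.exp (γ ^ 2 / (4 * β)))).congr (.of_forall fun r => ?_)
  dsimp only
  rw [← Real.exp_add]
  congr 1
  field_simp
  ring

theorem integral_exp_neg_mul_sq_add_mul (hβ : 0 < β) (γ : ℝ) :
    ∫ r : ℝ, Real.exp (-β * r ^ 2 + γ * r) = √(π / β) * Real.exp (γ ^ 2 / (4 * β)) := by
  rw [← integral_gaussian β, ← integral_sub_right_eq_self
    (fun r : ℝ => Real.exp (-β * r ^ 2)) (γ / (2 * β)), ← integral_mul_const]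
  congr with r
  rw [← Real.exp_add]
  congr 1
  field_simp
  ring

end RealGaussian

theorem norm_exp_sub_exp_le {z w : ℂ} {B : ℝ} (hz : z.re ≤ B) (hw : w.re ≤ B) :
    ‖exp z - exp w‖ ≤ Real.exp B * ‖z - w‖ := by
  refine Convex.norm_image_sub_le_of_norm_hasDerivWithin_le (s := {z : ℂ | z.re ≤ B})
    (fun x _ => (hasDerivAt_exp x).hasDerivWithinAt) (fun x hx => ?_)
    (convex_halfSpace_re_le B) hw hz
  rw [norm_exp]
  exact Real.exp_le_exp.mpr hx

section Saddle

/-- The exponent `-w log(g/h) + π(g² - h²)` at the point `g = h + ir`, where `w = 2πh²`. It is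
stationary at `r = 0`. -/
def saddleExponent (h : ℂ) (r : ℝ) : ℂ :=
  -(2 * π * h ^ 2) * (log (h + r * I) - log h) + π * ((h + r * I) ^ 2 - h ^ 2)

/-- The value `h^{-w} e^{πh²}`, `w = 2πh²`, at the saddle point. -/
def saddle (h : ℂ) : ℂ := h ^ (-(2 * π * h ^ 2)) * exp (π * h ^ 2)

variable {h : ℂ} {κ : ℝ}

theorem add_mul_I_mem_slitPlane (hre : 0 < h.re) (r : ℝ) : h + r * I ∈ slitPlane :=
  .inl (by simpa using hre)

theorem saddleExponent_zero (h : ℂ) : saddleExponent h 0 = 0 := by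
  simp [saddleExponent]

theorem hasDerivAt_saddleExponent (hre : 0 < h.re) (r : ℝ) :
    HasDerivAt (saddleExponent h) (-(2 * π * r) * (1 + h / (h + r * I))) r := by
  have hne := slitPlane_ne_zero (add_mul_I_mem_slitPlane hre r)
  have hline : HasDerivAt (fun r : ℝ => h + r * I) I r := by
    simpa using ((hasDerivAt_id r).ofReal_comp.mul_const I).const_add h
  refine ((((hline.clog_real (add_mul_I_mem_slitPlane hre r)).sub_const (log h)).const_mul
    (-(2 * π * h ^ 2))).add (((hline.pow 2).sub_const (h ^ 2)).const_mul (π : ℂ))).congr_deriv ?_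
  have hfactor : I * ((h + r * I) ^ 2 - h ^ 2) = -r * ((h + r * I) + h) := by
    linear_combination (2 * h * r + r ^ 2 * I : ℂ) * I_sq
  generalize h + r * I = g at hne hfactor ⊢
  simp only [Nat.add_one_sub_one, pow_one]
  field_simp
  push_cast
  linear_combination 2 * hfactor

theorem continuous_saddleExponent (hre : 0 < h.re) : Continuous (saddleExponent h) :=
  continuous_iff_continuousAt.mpr fun r => (hasDerivAt_saddleExponent hre r).continuousAt

theorem hasDerivAt_saddleExponent_mul (hre : 0 < h.re) (r t : ℝ) :
    HasDerivAt (fun t : ℝ => saddleExponent h (r * t))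
      ((-(2 * π * r ^ 2 * t) : ℝ) * (1 + h / (h + (r * t : ℝ) * I))) t := by
  refine ((hasDerivAt_saddleExponent hre (r * t)).scomp t
    ((hasDerivAt_id t).const_mul r)).congr_deriv ?_
  rw [real_smul]
  push_cast
  ring

theorem one_sub_le_re_one_add_div (hκ : 0 < κ) (hre : 0 < h.re)
    (him : h.im ^ 2 ≤ 4 * κ * (1 + κ) * h.re ^ 2) (r : ℝ) :
    1 - κ ≤ (1 + h / (h + r * I)).re := by
  have hnorm : 0 < normSq (h + r * I) :=
    normSq_pos.mpr (slitPlane_ne_zero (add_mul_I_mem_slitPlane hre r))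
  -- the bound on `h.im` is what makes the discriminant in `h.im + r` of this form nonpositive
  have hquad : 0 ≤ κ * (κ * (h.im + r) ^ 2 + h.im * (h.im + r) + (1 + κ) * h.re ^ 2) := by
    nlinarith [sq_nonneg (2 * κ * (h.im + r) + h.im)]
  have hdisc := nonneg_of_mul_nonneg_right hquad hκ
  rw [add_re, one_re, div_re, ← add_div, ← sub_le_iff_le_add', le_div_iff₀ hnorm, normSq_apply]
  simp only [add_re, add_im, re_ofReal_mul, im_ofReal_mul, I_re, I_im, mul_zero, mul_one, add_zero]
  nlinarith

theorem re_saddleExponent_le (hκ : 0 < κ) (hre : 0 < h.re)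
    (him : h.im ^ 2 ≤ 4 * κ * (1 + κ) * h.re ^ 2) (r : ℝ) :
    (saddleExponent h r).re ≤ -((1 - κ) * π) * r ^ 2 := by
  have hderiv (t : ℝ) :
      HasDerivAt (fun t : ℝ => (saddleExponent h (r * t)).re + (1 - κ) * π * r ^ 2 * t ^ 2)
        (-(2 * π * r ^ 2 * t) * ((1 + h / (h + (r * t : ℝ) * I)).re - (1 - κ))) t := by
    refine ((reCLM.hasFDerivAt.comp_hasDerivAt t (hasDerivAt_saddleExponent_mul hre r t)).add
      ((hasDerivAt_pow 2 t).const_mul ((1 - κ) * π * r ^ 2))).congr_deriv ?_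
    rw [reCLM_apply, re_ofReal_mul]
    push_cast
    ring
  have hanti : AntitoneOn
      (fun t : ℝ => (saddleExponent h (r * t)).re + (1 - κ) * π * r ^ 2 * t ^ 2) (Ici 0) := by
    refine antitoneOn_of_hasDerivWithinAt_nonpos (convex_Ici 0)
      (fun t _ => (hderiv t).continuousAt.continuousWithinAt)
      (fun t _ => (hderiv t).hasDerivWithinAt) fun t ht => ?_
    rw [interior_Ici, mem_Ioi] at ht
    exact mul_nonpos_of_nonpos_of_nonneg (neg_nonpos.mpr (by positivity))
      (sub_nonneg.mpr (one_sub_le_re_one_add_div hκ hre him (r * t)))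
  have hle := hanti (mem_Ici.mpr le_rfl) (mem_Ici.mpr zero_le_one) zero_le_one
  simp only [mul_zero, mul_one, saddleExponent_zero, zero_re] at hle
  linarith

theorem norm_saddleExponent_add_le (hre : 0 < h.re) (r : ℝ) :
    ‖saddleExponent h r + 2 * π * r ^ 2‖ ≤ 2 * π / (3 * h.re) * |r| ^ 3 := by
  set C := 2 * π / (3 * h.re) * |r| ^ 3 with hC
  have hderiv (t : ℝ) : HasDerivAt (fun t : ℝ => saddleExponent h (r * t) + 2 * π * r ^ 2 * t ^ 2)
      ((2 * π * r ^ 3 * t ^ 2 : ℝ) * I / (h + (r * t : ℝ) * I)) t := by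
    have hne := slitPlane_ne_zero (add_mul_I_mem_slitPlane hre (r * t))
    refine ((hasDerivAt_saddleExponent_mul hre r t).add
      (((hasDerivAt_id t).ofReal_comp.pow 2).const_mul (2 * π * r ^ 2 : ℂ))).congr_deriv ?_
    field_simp
    push_cast
    simp only [id_eq]
    ring
  have hbound (t : ℝ) :
      ‖(2 * π * r ^ 3 * t ^ 2 : ℝ) * I / (h + (r * t : ℝ) * I)‖ ≤ C * (3 * t ^ 2) := by
    have hden : h.re ≤ ‖h + (r * t : ℝ) * I‖ := by
      simpa using re_le_norm (h + (r * t : ℝ) * I)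
    rw [norm_div, norm_mul, norm_I, mul_one, norm_real, Real.norm_eq_abs, abs_mul, abs_mul,
      abs_pow, abs_of_pos Real.two_pi_pos, abs_of_nonneg (sq_nonneg t)]
    calc 2 * π * |r| ^ 3 * t ^ 2 / ‖h + (r * t : ℝ) * I‖
        ≤ 2 * π * |r| ^ 3 * t ^ 2 / h.re := by gcongr
      _ = C * (3 * t ^ 2) := by
          rw [hC]
          field_simp
  have hone := image_norm_le_of_norm_deriv_right_le_deriv_boundary
    (B := fun t => C * t ^ 3) (B' := fun t => C * (3 * t ^ 2))
    (fun t _ => (hderiv t).continuousAt.continuousWithinAt)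
    (fun t _ => (hderiv t).hasDerivWithinAt) (by simp [saddleExponent_zero])
    (fun t => by simpa using (hasDerivAt_pow 3 t).const_mul C) (fun t _ => hbound t)
    (right_mem_Icc.mpr zero_le_one)
  simpa using hone

end Saddle

section SaddleIntegral

variable {h : ℂ} {κ : ℝ}

theorem vertGauss_saddle (hre : 0 < h.re) (α : ℂ) :
    vertGauss h.re (2 * π * h ^ 2) α = saddle h * exp (π * α ^ 2 + 2 * π * h * α) *
      ∫ r : ℝ, exp (saddleExponent h r + 2 * π * α * I * r) := by
  rw [vertGauss, ← integral_add_right_eq_self _ h.im, ← integral_const_mul]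
  congr with r
  have hne := slitPlane_ne_zero (add_mul_I_mem_slitPlane hre r)
  have hne' : h ≠ 0 := by
    rintro rfl
    simp at hre
  have hpoint : (h.re : ℂ) + (r + h.im : ℝ) * I = h + r * I := by
    nth_rewrite 3 [← re_add_im h]
    push_cast
    ring
  rw [hpoint, saddle, saddleExponent, cpow_def_of_ne_zero hne, cpow_def_of_ne_zero hne']
  simp only [← exp_add]
  congr 1
  ring

theorem norm_exp_saddleExponent_add_le (hκ : 0 < κ) (hre : 0 < h.re)
    (him : h.im ^ 2 ≤ 4 * κ * (1 + κ) * h.re ^ 2) (z : ℂ) (r : ℝ) :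
    ‖exp (saddleExponent h r + z * r)‖ ≤ Real.exp (-((1 - κ) * π) * r ^ 2 + z.re * r) := by
  rw [norm_exp, add_re, re_mul_ofReal]
  gcongr
  exact re_saddleExponent_le hκ hre him r

theorem norm_integral_exp_saddleExponent_le (hκ : 0 < κ) (hκ' : κ < 1) (hre : 0 < h.re)
    (him : h.im ^ 2 ≤ 4 * κ * (1 + κ) * h.re ^ 2) (z : ℂ) :
    ‖∫ r : ℝ, exp (saddleExponent h r + z * r)‖ ≤
      √(1 / (1 - κ)) * Real.exp (z.re ^ 2 / (4 * ((1 - κ) * π))) := by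
  have hβ : 0 < (1 - κ) * π := mul_pos (sub_pos.mpr hκ') Real.pi_pos
  refine (norm_integral_le_of_norm_le (integrable_exp_neg_mul_sq_add_mul hβ z.re)
    (.of_forall (norm_exp_saddleExponent_add_le hκ hre him z))).trans_eq ?_
  rw [integral_exp_neg_mul_sq_add_mul hβ, div_mul_cancel_right₀ Real.pi_ne_zero, one_div]

theorem abs_pow_three_le_exp (r : ℝ) : |r| ^ 3 ≤ Real.exp (0.45 * π * r ^ 2) := by
  have hexp := Real.quadratic_le_exp_of_nonneg (show 0 ≤ 0.45 * π * r ^ 2 by positivity)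
  have hpi : 1.35 ≤ 0.45 * π := by linarith [Real.pi_gt_three]
  have hle : 1.35 * r ^ 2 ≤ 0.45 * π * r ^ 2 := by gcongr
  have hsq : (1.35 * r ^ 2) ^ 2 ≤ (0.45 * π * r ^ 2) ^ 2 := by gcongr
  rw [← sq_abs r] at hle hsq hexp ⊢
  nlinarith [sq_nonneg (|r| * (|r| - 1)), abs_nonneg r]

theorem norm_exp_saddleExponent_sub_le (hre : 0 < h.re) (him : h.im ^ 2 ≤ 0.21 * h.re ^ 2)
    (z : ℂ) (r : ℝ) :
    ‖exp (saddleExponent h r + z * r) - exp (-(2 * π * r ^ 2) + z * r)‖ ≤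
      2 * π / (3 * h.re) * Real.exp (-(π / 2) * r ^ 2 + z.re * r) := by
  have hquad : (-(2 * π * r ^ 2) : ℂ).re ≤ -(0.95 * π) * r ^ 2 := by
    rw [show (-(2 * π * r ^ 2) : ℂ) = (-(2 * π * r ^ 2) : ℝ) by push_cast; ring, ofReal_re]
    nlinarith [mul_nonneg Real.pi_pos.le (sq_nonneg r)]
  have hsaddle : (saddleExponent h r).re ≤ -(0.95 * π) * r ^ 2 := by
    convert! re_saddleExponent_le (κ := 0.05) (by norm_num) hre
      (him.trans_eq (by norm_num)) r using 4
    norm_num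
  have hsub := norm_exp_sub_exp_le hsaddle hquad
  rw [sub_neg_eq_add] at hsub
  have hcube : ‖exp (saddleExponent h r) - exp (-(2 * π * r ^ 2))‖ ≤
      2 * π / (3 * h.re) * (Real.exp (-(0.95 * π) * r ^ 2) * Real.exp (0.45 * π * r ^ 2)) := by
    calc ‖exp (saddleExponent h r) - exp (-(2 * π * r ^ 2))‖
        ≤ Real.exp (-(0.95 * π) * r ^ 2) * (2 * π / (3 * h.re) * |r| ^ 3) :=
          hsub.trans (by gcongr; exact norm_saddleExponent_add_le hre r)
      _ ≤ Real.exp (-(0.95 * π) * r ^ 2) *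
            (2 * π / (3 * h.re) * Real.exp (0.45 * π * r ^ 2)) := by
          gcongr
          exact abs_pow_three_le_exp r
      _ = _ := mul_left_comm _ _ _
  rw [exp_add, exp_add, ← sub_mul, norm_mul, norm_exp (z * r), re_mul_ofReal, Real.exp_add,
    ← mul_assoc]
  gcongr
  rw [← Real.exp_add] at hcube
  convert! hcube using 3
  ring

theorem integrable_exp_saddleExponent (hre : 0 < h.re) (him : h.im ^ 2 ≤ 0.21 * h.re ^ 2) (z : ℂ) :
    Integrable fun r : ℝ => exp (saddleExponent h r + z * r) := by
  have hcont := continuous_saddleExponent hre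
  refine (integrable_exp_neg_mul_sq_add_mul (by positivity : 0 < (1 - 0.05) * π) z.re).mono'
    (Continuous.aestronglyMeasurable (by fun_prop)) (.of_forall fun r => ?_)
  exact norm_exp_saddleExponent_add_le (by norm_num) hre (him.trans_eq (by norm_num)) z r

theorem integrable_exp_neg_two_pi_mul_sq (z : ℂ) :
    Integrable fun r : ℝ => exp (-(2 * π * r ^ 2) + z * r) := by
  simpa using integrable_cexp_quadratic (b := 2 * π) (by simpa using Real.pi_pos) z 0

theorem integral_exp_neg_two_pi_mul_sq (z : ℂ) :
    ∫ r : ℝ, exp (-(2 * π * r ^ 2) + z * r) = exp (z ^ 2 / (8 * π)) / √2 := by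
  have hpi : (π : ℂ) ≠ 0 := ofReal_ne_zero.mpr Real.pi_ne_zero
  have hroot : (π / (2 * π) : ℂ) ^ (1 / 2 : ℂ) = (√2 : ℂ)⁻¹ := by
    rw [show (π / (2 * π) : ℂ) = ((2⁻¹ : ℝ) : ℂ) by push_cast; field_simp,
      show (1 / 2 : ℂ) = ((1 / 2 : ℝ) : ℂ) by push_cast; rfl, ← ofReal_cpow (by norm_num),
      ← Real.sqrt_eq_rpow, Real.sqrt_inv, ofReal_inv]
  have hgauss := integral_cexp_quadratic (b := -(2 * π)) (by simpa using Real.pi_pos) z 0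
  rw [neg_neg, hroot, ← div_eq_inv_mul] at hgauss
  convert! hgauss using 3 <;> ring_nf

theorem norm_integral_exp_saddleExponent_sub_le (hre : 0 < h.re)
    (him : h.im ^ 2 ≤ 0.21 * h.re ^ 2) (z : ℂ) :
    ‖(∫ r : ℝ, exp (saddleExponent h r + z * r)) - exp (z ^ 2 / (8 * π)) / √2‖ ≤
      2 * π / (3 * h.re) * (√2 * Real.exp (z.re ^ 2 / (2 * π))) := by
  have hβ : 0 < π / 2 := by positivity
  rw [← integral_exp_neg_two_pi_mul_sq, ← integral_sub (integrable_exp_saddleExponent hre him z)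
    (integrable_exp_neg_two_pi_mul_sq z)]
  refine (norm_integral_le_of_norm_le ((integrable_exp_neg_mul_sq_add_mul hβ z.re).const_mul _)
    (.of_forall (norm_exp_saddleExponent_sub_le hre him z))).trans_eq ?_
  rw [integral_const_mul, integral_exp_neg_mul_sq_add_mul hβ, show π / (π / 2) = 2 by field_simp]
  ring_nf

theorem exp_shift (h : ℂ) (k : ℕ) :
    exp (π * shift k ^ 2 + 2 * π * h * shift k) =
      exp (-(π * I / 4)) * exp ((2 * k + 1) * (π * I * (ω * h))) := by
  -- `e^{-πi(2k+1)²/4}` does not depend on `k` because `k (k + 1)` is even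
  obtain ⟨j, hj⟩ := Nat.even_mul_succ_self k
  have hj' : (k : ℂ) * (k + 1) = j + j := by exact_mod_cast hj
  rw [← exp_add, exp_eq_exp_iff_exists_int]
  refine ⟨-j, ?_⟩
  rw [shift]
  push_cast
  linear_combination (π * (2 * k + 1) ^ 2 / 4 * ω ^ 2 : ℂ) * I_sq -
    (π * (2 * k + 1) ^ 2 / 4 : ℂ) * ω_sq - π * I * hj'

theorem two_pi_mul_shift_mul_I (k : ℕ) :
    2 * π * shift k * I = (-((2 * k + 1) * π) : ℝ) * ω := by
  rw [shift]
  push_cast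
  linear_combination (π * (2 * k + 1) * ω : ℂ) * I_sq

theorem re_two_pi_mul_shift_mul_I_sq (k : ℕ) :
    (2 * π * shift k * I).re ^ 2 = (2 * k + 1) ^ 2 * π ^ 2 / 2 := by
  rw [two_pi_mul_shift_mul_I, re_ofReal_mul, ω_re]
  linear_combination ((2 * k + 1) ^ 2 * π ^ 2 / 4 : ℝ) * Real.sq_sqrt (zero_le_two (α := ℝ))

theorem norm_exp_shift (h : ℂ) (k : ℕ) :
    ‖exp (π * shift k ^ 2 + 2 * π * h * shift k)‖ = Real.exp (-((2 * k + 1) * π * (ω * h).im)) := by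
  rw [exp_shift, norm_mul, show (-(π * I / 4) : ℂ) = (-(π / 4) : ℝ) * I by push_cast; ring,
    norm_exp_ofReal_mul_I, one_mul, norm_exp,
    show ((2 * k + 1) * (π * I * (ω * h)) : ℂ) = ((2 * k + 1) * π : ℝ) * (I * (ω * h)) by
      push_cast; ring, re_ofReal_mul, I_mul_re]
  ring_nf

theorem norm_vertGauss_shift_saddle_le (hre : 0 < h.re) (him : h.im ^ 2 ≤ 0.21 * h.re ^ 2)
    (k : ℕ) :
    ‖vertGauss h.re (2 * π * h ^ 2) (shift k)‖ ≤
      ‖saddle h‖ * (1.03 * Real.exp (π * ((2 * k + 1) ^ 2 / 7.6 - (2 * k + 1) * (ω * h).im))) := by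
  have hint := norm_integral_exp_saddleExponent_le (κ := 0.05) (by norm_num) (by norm_num) hre
    (him.trans_eq (by norm_num)) (2 * π * shift k * I)
  have hroot : √(1 / (1 - 0.05)) ≤ 1.03 := by
    rw [Real.sqrt_le_left (by norm_num)]
    norm_num
  have hexp : (2 * π * shift k * I).re ^ 2 / (4 * ((1 - 0.05) * π)) =
      π * ((2 * k + 1) ^ 2 / 7.6) := by
    rw [re_two_pi_mul_shift_mul_I_sq]
    field_simp
    norm_num
  rw [hexp] at hint
  rw [vertGauss_saddle hre, norm_mul, norm_mul, norm_exp_shift, mul_assoc]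
  gcongr ‖saddle h‖ * ?_
  calc Real.exp (-((2 * k + 1) * π * (ω * h).im)) *
        ‖∫ r : ℝ, exp (saddleExponent h r + 2 * π * shift k * I * r)‖
      ≤ Real.exp (-((2 * k + 1) * π * (ω * h).im)) *
          (1.03 * Real.exp (π * ((2 * k + 1) ^ 2 / 7.6))) := by
        gcongr
        exact hint.trans (by gcongr)
    _ = 1.03 * Real.exp (π * ((2 * k + 1) ^ 2 / 7.6 - (2 * k + 1) * (ω * h).im)) := by
        rw [mul_left_comm, ← Real.exp_add]
        ring_nf

theorem exists_vertGauss_shift_zero_saddle_eq (hre : 0 < h.re)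
    (him : h.im ^ 2 ≤ 0.21 * h.re ^ 2) :
    ∃ δ : ℂ, ‖δ‖ ≤ 2 * π / (3 * h.re) * (√2 * Real.exp (π / 4)) ∧
      vertGauss h.re (2 * π * h ^ 2) (shift 0) =
        saddle h * (exp (-(π * I / 4)) * exp (π * I * (ω * h))) *
          (exp (π * I / 8) / √2 + δ) := by
  have hpi : (π : ℂ) ≠ 0 := ofReal_ne_zero.mpr Real.pi_ne_zero
  set z := 2 * π * shift 0 * I with hz
  have hsq : z ^ 2 / (8 * π) = π * I / 8 := by
    rw [hz, two_pi_mul_shift_mul_I, mul_pow, ω_sq]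
    push_cast
    field_simp
    ring
  have hre_sq : z.re ^ 2 / (2 * π) = π / 4 := by
    rw [hz, re_two_pi_mul_shift_mul_I_sq]
    push_cast
    field_simp
    ring
  have hbound := norm_integral_exp_saddleExponent_sub_le hre him z
  rw [hsq, hre_sq] at hbound
  refine ⟨_, hbound, ?_⟩
  rw [vertGauss_saddle hre, exp_shift, add_sub_cancel, ← hz, Nat.cast_zero, mul_zero, zero_add,
    one_mul]

end SaddleIntegral

section FarTerms

theorem cos_sub_sin_le_exp_neg {d : ℝ} (hd : |d| ≤ 1) :
    Real.cos d - Real.sin d ≤ Real.exp (-d) := by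
  have hcos := (abs_le.mp (Real.cos_bound hd)).2
  have hsin := (abs_le.mp (Real.sin_bound hd)).1
  have hfour : |d| ^ 4 = d ^ 2 * d ^ 2 := by
    rw [(by norm_num : Even 4).pow_abs]
    ring
  have hfive : |d| ^ 5 ≤ d ^ 2 := by
    rw [← sq_abs]
    exact pow_le_pow_of_le_one (abs_nonneg d) hd (by norm_num)
  rw [hfour] at hcos
  have hcube : d * d ^ 2 ≤ d ^ 2 := mul_le_of_le_one_left (sq_nonneg d) (abs_le.mp hd).2
  have hsq : d ^ 2 * d ^ 2 ≤ d ^ 2 :=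
    mul_le_of_le_one_left (sq_nonneg d) ((sq_le_one_iff_abs_le_one d).mpr hd)
  linarith [Real.add_one_le_exp (-d), sq_nonneg d]

theorem cos_mul_exp_le {x : ℝ} (hx : x ∈ Icc 0 (π / 2)) :
    Real.cos x * Real.exp x ≤ Real.exp (π / 4) * (√2 / 2) := by
  obtain ⟨d, rfl⟩ : ∃ d, x = π / 4 + d := ⟨x - π / 4, by ring⟩
  have hd : |d| ≤ 1 := by
    rw [abs_le]
    constructor <;> linarith [hx.1, hx.2, Real.pi_lt_four]
  calc Real.cos (π / 4 + d) * Real.exp (π / 4 + d)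
      = Real.exp (π / 4) * (√2 / 2) * ((Real.cos d - Real.sin d) * Real.exp d) := by
        rw [Real.cos_add, Real.cos_pi_div_four, Real.sin_pi_div_four, Real.exp_add]
        ring
    _ ≤ Real.exp (π / 4) * (√2 / 2) * (Real.exp (-d) * Real.exp d) := by
        gcongr
        exact cos_sub_sin_le_exp_neg hd
    _ = Real.exp (π / 4) * (√2 / 2) := by
        rw [← Real.exp_add, neg_add_cancel, Real.exp_zero, mul_one]

theorem exp_abs_arg_mul_re_le {z : ℂ} (hz : 0 < z.re) :
    Real.exp |z.arg| * z.re ≤ Real.exp (π / 4) * (√2 / 2) * ‖z‖ := by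
  have hcos := cos_mul_exp_le ⟨abs_nonneg _, abs_arg_le_pi_div_two_iff.mpr hz.le⟩
  rw [Real.cos_abs] at hcos
  calc Real.exp |z.arg| * z.re = Real.cos z.arg * Real.exp |z.arg| * ‖z‖ := by
        rw [← norm_mul_cos_arg z]
        ring
    _ ≤ Real.exp (π / 4) * (√2 / 2) * ‖z‖ := by gcongr

theorem norm_cpow_neg_le {w z : ℂ} (hz : 0 < z.re) (hw : |w.im| ≤ w.re) :
    ‖z ^ (-w)‖ ≤ (Real.exp (π / 4) * (√2 / 2) / z.re) ^ w.re := by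
  have hz0 : z ≠ 0 := by
    rintro rfl
    simp at hz
  have hn : 0 < ‖z‖ := norm_pos_iff.mpr hz0
  have harg : z.arg * w.im ≤ |z.arg| * w.re := by
    calc z.arg * w.im ≤ |z.arg| * |w.im| := (le_abs_self _).trans (abs_mul _ _).le
      _ ≤ |z.arg| * w.re := by gcongr
  calc ‖z ^ (-w)‖ = ‖z‖ ^ (-w.re) * Real.exp (z.arg * w.im) := by
        rw [norm_cpow_of_ne_zero hz0, div_eq_mul_inv, ← Real.exp_neg, neg_re, neg_im, mul_neg,
          neg_neg]
    _ ≤ ‖z‖ ^ (-w.re) * Real.exp (|z.arg| * w.re) := by gcongr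
    _ = (Real.exp |z.arg| / ‖z‖) ^ w.re := by
        rw [Real.div_rpow (Real.exp_pos _).le hn.le, Real.rpow_neg hn.le, Real.exp_mul]
        ring
    _ ≤ (Real.exp (π / 4) * (√2 / 2) / z.re) ^ w.re := by
        refine Real.rpow_le_rpow (by positivity) ?_ ((abs_nonneg _).trans hw)
        rw [div_le_div_iff₀ hn hz]
        exact exp_abs_arg_mul_re_le hz

theorem norm_vertGauss_neg_re_le {w α : ℂ} (hα : α.re < 0) (hw : |w.im| ≤ w.re) :
    ‖vertGauss (-α.re) w α‖ ≤ (Real.exp (π / 4) * (√2 / 2) / -α.re) ^ w.re := by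
  -- on the line `Re g = -Re α` the exponential factor has modulus `exp (-π (r + Im α)²) ≤ 1`
  set A := (Real.exp (π / 4) * (√2 / 2) / -α.re) ^ w.re
  have hint : Integrable fun r : ℝ => A * Real.exp (-π * (r + α.im) ^ 2) :=
    ((integrable_exp_neg_mul_sq Real.pi_pos).comp_add_right _).const_mul A
  refine (norm_integral_le_of_norm_le hint (.of_forall fun r => ?_)).trans_eq ?_
  · have hre : ((-α.re : ℝ) + r * I : ℂ).re = -α.re := by simp
    have hpow := norm_cpow_neg_le (hre.symm ▸ neg_pos.mpr hα) hw
    rw [hre] at hpow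
    rw [norm_mul, norm_exp_vert, neg_add_cancel, zero_pow two_ne_zero, mul_zero, Real.exp_zero,
      one_mul]
    gcongr
  · rw [integral_const_mul, integral_add_right_eq_self (fun r : ℝ => Real.exp (-π * r ^ 2)),
      integral_gaussian, div_self Real.pi_ne_zero, Real.sqrt_one, mul_one]

variable {h : ℂ}

theorem arg_mul_im_sq_nonneg (hre : 0 < h.re) : 0 ≤ h.arg * (h ^ 2).im := by
  rw [pow_two, mul_im]
  rcases le_or_gt 0 h.im with him | him
  · exact mul_nonneg (arg_nonneg_iff.mpr him) (by positivity)
  · refine mul_nonneg_of_nonpos_of_nonpos (arg_neg_iff.mpr him).le ?_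
    nlinarith [mul_pos_of_neg_of_neg him (neg_neg_of_pos hre)]

theorem le_norm_saddle (hre : 0 < h.re) :
    (Real.exp (1 / 2) / ‖h‖) ^ (2 * π * h ^ 2 : ℂ).re ≤ ‖saddle h‖ := by
  have h0 : h ≠ 0 := by
    rintro rfl
    simp at hre
  have hn : 0 < ‖h‖ := norm_pos_iff.mpr h0
  have hw : (2 * π * h ^ 2 : ℂ) = (2 * π : ℝ) * h ^ 2 := by push_cast; ring
  have hhalf : (π * h ^ 2 : ℂ).re = 1 / 2 * (2 * π * h ^ 2 : ℂ).re := by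
    rw [hw, re_ofReal_mul, re_ofReal_mul]
    ring
  have harg : 1 ≤ Real.exp (h.arg * (2 * π * h ^ 2 : ℂ).im) := by
    rw [Real.one_le_exp_iff, hw, im_ofReal_mul, mul_left_comm]
    exact mul_nonneg Real.two_pi_pos.le (arg_mul_im_sq_nonneg hre)
  calc (Real.exp (1 / 2) / ‖h‖) ^ (2 * π * h ^ 2 : ℂ).re
      = ‖h‖ ^ (-(2 * π * h ^ 2 : ℂ).re) * Real.exp (π * h ^ 2 : ℂ).re := by
        rw [Real.div_rpow (Real.exp_pos _).le hn.le, Real.rpow_neg hn.le, hhalf, Real.exp_mul]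
        ring
    _ ≤ ‖h‖ ^ (-(2 * π * h ^ 2 : ℂ).re) * Real.exp (h.arg * (2 * π * h ^ 2 : ℂ).im) *
          Real.exp (π * h ^ 2 : ℂ).re := by
        gcongr
        exact le_mul_of_one_le_right (by positivity) harg
    _ = ‖saddle h‖ := by
        rw [saddle, norm_mul, norm_exp, norm_cpow_of_ne_zero h0, div_eq_mul_inv, ← Real.exp_neg,
          neg_re, neg_im, mul_neg, neg_neg]

theorem re_shift (k : ℕ) : (shift k).re = -((2 * k + 1) * (√2 / 4)) := by
  rw [shift, show ((2 * k + 1) * (I * ω / 2) : ℂ) = ((2 * k + 1) / 2 : ℝ) * (I * ω) by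
    push_cast; ring, re_ofReal_mul, I_mul_re, ω_im]
  ring

theorem norm_vertGauss_shift_far_le (hre : 0 < h.re)
    (hw : |(2 * π * h ^ 2 : ℂ).im| ≤ (2 * π * h ^ 2 : ℂ).re) (k : ℕ) :
    ‖vertGauss ((2 * k + 1) * (√2 / 4)) (2 * π * h ^ 2) (shift k)‖ ≤
      ‖saddle h‖ * (2 * Real.exp (π / 4 - 1 / 2) * ‖h‖ / (2 * k + 1)) ^
        (2 * π * h ^ 2 : ℂ).re := by
  have hn : 0 < ‖h‖ := hre.trans_le (re_le_norm h)
  have hneg : (shift k).re < 0 := by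
    rw [re_shift]
    exact neg_neg_of_pos (by positivity)
  have hfar := norm_vertGauss_neg_re_le hneg hw
  rw [re_shift, neg_neg] at hfar
  calc ‖vertGauss ((2 * k + 1) * (√2 / 4)) (2 * π * h ^ 2) (shift k)‖
      ≤ (Real.exp (π / 4) * (√2 / 2) / ((2 * k + 1) * (√2 / 4))) ^ (2 * π * h ^ 2 : ℂ).re := hfar
    _ = (Real.exp (1 / 2) / ‖h‖) ^ (2 * π * h ^ 2 : ℂ).re *
          (2 * Real.exp (π / 4 - 1 / 2) * ‖h‖ / (2 * k + 1)) ^ (2 * π * h ^ 2 : ℂ).re := by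
        rw [← Real.mul_rpow (by positivity) (by positivity), Real.exp_sub]
        congr 1
        field_simp
        norm_num
    _ ≤ _ := by
        gcongr
        exact le_norm_saddle hre

end FarTerms

section Sector

theorem im_sq_le_of_abs_le {h : ℂ} (hre : 0 < h.re)
    (hs : |2 * (h.re * h.im)| ≤ h.re ^ 2 - h.im ^ 2) : h.im ^ 2 ≤ 0.18 * h.re ^ 2 := by
  rw [abs_mul, abs_mul, abs_two, abs_of_pos hre] at hs
  have him : |h.im| ≤ 0.42 * h.re := by
    by_contra! hlt
    nlinarith [sq_abs h.im]
  nlinarith [sq_abs h.im, abs_nonneg h.im]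

theorem norm_sq_bounds_of_abs_le {h : ℂ} (hs : |2 * (h.re * h.im)| ≤ h.re ^ 2 - h.im ^ 2) :
    0.707 * ‖h‖ ^ 2 ≤ h.re ^ 2 - h.im ^ 2 ∧ |2 * (h.re * h.im)| ≤ 0.7072 * ‖h‖ ^ 2 := by
  have hpyth : (‖h‖ ^ 2) ^ 2 = (h.re ^ 2 - h.im ^ 2) ^ 2 + |2 * (h.re * h.im)| ^ 2 := by
    rw [sq_abs, ← normSq_eq_norm_sq, normSq_apply]
    ring
  have habs := abs_nonneg (2 * (h.re * h.im))
  constructor <;> by_contra! hlt <;> nlinarith [habs, sq_nonneg ‖h‖]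

theorem two_pi_mul_sq_re (h : ℂ) :
    (2 * π * h ^ 2 : ℂ).re = 2 * π * (h.re ^ 2 - h.im ^ 2) := by
  rw [show (2 * π * h ^ 2 : ℂ) = (2 * π : ℝ) * h ^ 2 by push_cast; ring, re_ofReal_mul, pow_two,
    mul_re]
  ring

theorem two_pi_mul_sq_im (h : ℂ) : (2 * π * h ^ 2 : ℂ).im = 2 * π * (2 * (h.re * h.im)) := by
  rw [show (2 * π * h ^ 2 : ℂ) = (2 * π : ℝ) * h ^ 2 by push_cast; ring, im_ofReal_mul, pow_two,
    mul_im]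
  ring

theorem ω_mul_im_le_norm (h : ℂ) : (ω * h).im ≤ ‖h‖ := by
  simpa only [norm_mul, norm_ω, one_mul] using im_le_norm (ω * h)

/-- The points `h` with `|arg h| ≤ π / 8` and `|h| ≥ 42`; the condition on the argument is
expressed as `|Im h²| ≤ Re h²`. -/
structure InSector (h : ℂ) : Prop where
  re_pos : 0 < h.re
  abs_im_sq_le : |2 * (h.re * h.im)| ≤ h.re ^ 2 - h.im ^ 2
  le_norm : 42 ≤ ‖h‖

namespace InSector

variable {h : ℂ} (H : InSector h)
include H

theorem im_sq_le : h.im ^ 2 ≤ 0.18 * h.re ^ 2 := im_sq_le_of_abs_le H.re_pos H.abs_im_sq_le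

theorem le_re : 38 ≤ h.re := by
  have hnorm : 42 ^ 2 ≤ h.re * h.re + h.im * h.im := by
    rw [← normSq_apply, normSq_eq_norm_sq]
    gcongr
    exact H.le_norm
  nlinarith [H.im_sq_le, H.re_pos]

theorem abs_im_exponent_le : |(2 * π * h ^ 2 : ℂ).im| ≤ (2 * π * h ^ 2 : ℂ).re := by
  rw [two_pi_mul_sq_im, two_pi_mul_sq_re, abs_mul, abs_of_pos Real.two_pi_pos]
  have := Real.pi_pos
  gcongr
  exact H.abs_im_sq_le

theorem le_re_exponent : 4.44 * ‖h‖ ^ 2 ≤ (2 * π * h ^ 2 : ℂ).re := by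
  rw [two_pi_mul_sq_re]
  calc 4.44 * ‖h‖ ^ 2 ≤ 2 * 3.1415 * (0.707 * ‖h‖ ^ 2) := by linarith [sq_nonneg ‖h‖]
    _ ≤ 2 * π * (h.re ^ 2 - h.im ^ 2) := by
        gcongr
        · exact Real.pi_gt_d4.le
        · exact (norm_sq_bounds_of_abs_le H.abs_im_sq_le).1

theorem one_lt_re_exponent : 1 < (2 * π * h ^ 2 : ℂ).re := by
  nlinarith [H.le_re_exponent, H.le_norm]

theorem ω_mul_im_pos : 0 < (ω * h).im := by
  have hlt : |h.im| < h.re := abs_lt_of_sq_lt_sq (by nlinarith [H.im_sq_le, H.re_pos]) H.re_pos.le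
  rw [ω_mul_im]
  have : 0 < h.re + h.im := by linarith [(abs_lt.mp hlt).1]
  positivity

theorem le_ω_mul_im_sq : 0.1464 * ‖h‖ ^ 2 ≤ (ω * h).im ^ 2 := by
  have hsq : (ω * h).im ^ 2 = (‖h‖ ^ 2 + 2 * (h.re * h.im)) / 2 := by
    rw [ω_mul_im, mul_pow, div_pow, Real.sq_sqrt (by norm_num), ← normSq_eq_norm_sq, normSq_apply]
    ring
  rw [hsq]
  linarith [(abs_le.mp (norm_sq_bounds_of_abs_le H.abs_im_sq_le).2).1]

theorem norm_le_ω_mul_im : ‖h‖ ≤ 2.6136 * (ω * h).im := by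
  refine le_of_sq_le_sq ?_ (by linarith [H.ω_mul_im_pos])
  linarith [H.le_ω_mul_im_sq, sq_nonneg (ω * h).im]

theorem le_ω_mul_im : 16 ≤ (ω * h).im := by
  linarith [H.norm_le_ω_mul_im, H.le_norm]

end InSector

end Sector

section Remainder

theorem mul_sq_le_exp {x : ℝ} (hx : 16 ≤ x) : 1000 * x ^ 2 ≤ Real.exp (5.8 * x) := by
  have hexp : (5.8 * x) ^ 4 / 24 ≤ Real.exp (5.8 * x) :=
    Real.pow_div_factorial_le_exp (5.8 * x) (by linarith) 4
  have hsq : 256 ≤ x ^ 2 := by nlinarith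
  nlinarith [mul_nonneg (sq_nonneg x) (sub_nonneg.mpr hsq)]

theorem sq_div_sub_mul_le {m y : ℝ} (hm : 3 ≤ m) (hy : 16 ≤ y) (hmy : m ≤ 7.32 * y) :
    m ^ 2 / 7.6 - m * y ≤ -2.88 * y := by
  have hprod : (m - 3) * (m - 7.32 * y) ≤ 0 :=
    mul_nonpos_of_nonneg_of_nonpos (by linarith) (by linarith)
  have hlin : 0 ≤ m * (0.036 * y - 0.395) := mul_nonneg (by linarith) (by linarith)
  have hmul : 0 ≤ m * y := by positivity
  have hdiv : m ^ 2 / 7.6 ≤ m * y - 2.88 * y := by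
    rw [div_le_iff₀ (by norm_num)]
    linarith [hprod, hlin, hmul]
  linarith

theorem exp_sq_div_sub_mul_le {m y : ℝ} (hm : 3 ≤ m) (hy : 16 ≤ y) (hmy : m ≤ 7.32 * y) :
    1.03 * Real.exp (π * (m ^ 2 / 7.6 - m * y)) ≤ Real.exp (-(π * y)) * (0.1 / m ^ 2) := by
  have hexponent : π * (m ^ 2 / 7.6 - m * y) ≤ -(π * y) + -(5.8 * y) := by
    calc π * (m ^ 2 / 7.6 - m * y) ≤ π * (-2.88 * y) := by
          gcongr
          exact sq_div_sub_mul_le hm hy hmy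
      _ ≤ -(π * y) + -(5.8 * y) := by nlinarith [Real.pi_gt_d2]
  have hdecay : 1.03 * Real.exp (-(5.8 * y)) ≤ 0.1 / m ^ 2 := by
    have hsq : m ^ 2 ≤ (7.32 * y) ^ 2 := by gcongr
    rw [Real.exp_neg, le_div_iff₀ (by positivity), ← div_eq_mul_inv, div_mul_eq_mul_div,
      div_le_iff₀ (Real.exp_pos _)]
    linarith [mul_sq_le_exp hy, sq_nonneg y]
  calc 1.03 * Real.exp (π * (m ^ 2 / 7.6 - m * y))
      ≤ 1.03 * Real.exp (-(π * y) + -(5.8 * y)) := by gcongr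
    _ = Real.exp (-(π * y)) * (1.03 * Real.exp (-(5.8 * y))) := by
        rw [Real.exp_add]
        ring
    _ ≤ Real.exp (-(π * y)) * (0.1 / m ^ 2) := by gcongr

theorem two_mul_exp_pi_div_four_sub_half_le : 2 * Real.exp (π / 4 - 1 / 2) ≤ 2.662 := by
  have hexp : Real.exp 0.2854 ≤ 1.331 := by
    refine (Real.exp_bound' (by norm_num) (by norm_num) (n := 5) (by norm_num)).trans ?_
    norm_num [Finset.sum_range_succ, Nat.factorial]
  have hmono : Real.exp (π / 4 - 1 / 2) ≤ Real.exp 0.2854 :=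
    Real.exp_le_exp.mpr (by linarith [Real.pi_lt_d4])
  linarith

theorem rpow_le_exp_neg {q y N W : ℝ} (hq : 0 ≤ q) (hq' : q ≤ Real.exp (-0.049)) (hN : 42 ≤ N)
    (hy : y ≤ N) (hW : 4.44 * N ^ 2 ≤ W) :
    q ^ (W - 2) ≤ Real.exp (-(π * y)) * Real.exp (-(5.8 * N)) := by
  calc q ^ (W - 2) ≤ Real.exp (-0.049) ^ (W - 2) :=
        Real.rpow_le_rpow hq hq' (by nlinarith)
    _ = Real.exp (-0.049 * (W - 2)) := (Real.exp_mul _ _).symm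
    _ ≤ Real.exp (-(π * y) + -(5.8 * N)) := by
        have hpi : π * y ≤ 3.15 * N := by
          calc π * y ≤ π * N := by gcongr
            _ ≤ 3.15 * N := by
              gcongr
              exact Real.pi_lt_d2.le
        gcongr
        nlinarith
    _ = Real.exp (-(π * y)) * Real.exp (-(5.8 * N)) := Real.exp_add _ _

theorem mul_div_rpow_le {m y N W : ℝ} (hN : 42 ≤ N) (hy : y ≤ N) (hm : 2.8 * N ≤ m)
    (hW : 4.44 * N ^ 2 ≤ W) :
    (2 * Real.exp (π / 4 - 1 / 2) * N / m) ^ W ≤ Real.exp (-(π * y)) * (0.1 / m ^ 2) := by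
  have hm0 : 0 < m := by linarith
  set q := 2 * Real.exp (π / 4 - 1 / 2) * N / m with hq
  have hq0 : 0 < q := by positivity
  have hqm : q ≤ 2.662 * N / m := by
    rw [hq]
    gcongr
    exact two_mul_exp_pi_div_four_sub_half_le
  have hqexp : q ≤ Real.exp (-0.049) := by
    refine hqm.trans ((div_le_iff₀ hm0).mpr ?_)
    nlinarith [Real.add_one_le_exp (-0.049)]
  have hdecay : q ^ 2 * Real.exp (-(5.8 * N)) ≤ 0.1 / m ^ 2 := by
    calc q ^ 2 * Real.exp (-(5.8 * N)) ≤ (2.662 * N / m) ^ 2 * Real.exp (-(5.8 * N)) := by gcongr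
      _ = 2.662 ^ 2 * N ^ 2 / Real.exp (5.8 * N) / m ^ 2 := by
          rw [Real.exp_neg]
          field_simp
      _ ≤ 0.1 / m ^ 2 := by
          gcongr
          rw [div_le_iff₀ (Real.exp_pos _)]
          linarith [mul_sq_le_exp (show 16 ≤ N by linarith), sq_nonneg N]
  calc q ^ W = q ^ (W - 2) * q ^ 2 := by
        rw [← Real.rpow_two, ← Real.rpow_add hq0, sub_add_cancel]
    _ ≤ Real.exp (-(π * y)) * Real.exp (-(5.8 * N)) * q ^ 2 := by
        gcongr
        exact rpow_le_exp_neg hq0.le hqexp hN hy hW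
    _ = Real.exp (-(π * y)) * (q ^ 2 * Real.exp (-(5.8 * N))) := by ring
    _ ≤ Real.exp (-(π * y)) * (0.1 / m ^ 2) := by gcongr

theorem sum_inv_odd_sq_le (n : ℕ) :
    ∑ k ∈ Finset.range n, 0.1 / (2 * k + 3 : ℝ) ^ 2 ≤ 0.05 := by
  suffices h : ∑ k ∈ Finset.range n, 0.1 / (2 * k + 3 : ℝ) ^ 2 ≤ 0.05 - 0.05 / (2 * n + 1 : ℝ) from
    h.trans (sub_le_self _ (by positivity))
  induction n with
  | zero => norm_num
  | succ n ih =>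
    have hn : (0 : ℝ) ≤ n := n.cast_nonneg
    have htelescope : 0.05 / (2 * n + 1 : ℝ) - 0.05 / (2 * n + 3) =
        0.1 / ((2 * n + 1) * (2 * n + 3)) := by
      field_simp
      ring
    have hterm : 0.1 / (2 * n + 3 : ℝ) ^ 2 ≤ 0.1 / ((2 * n + 1) * (2 * n + 3)) := by
      gcongr
      nlinarith [hn]
    rw [Finset.sum_range_succ, Nat.cast_succ, show (2 * (n + 1 : ℝ) + 1) = 2 * n + 3 by ring]
    linarith

theorem norm_vertGauss_shift_succ_le {h : ℂ} (H : InSector h) (k : ℕ) :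
    ‖vertGauss h.re (2 * π * h ^ 2) (shift (k + 1))‖ ≤
      ‖saddle h‖ * (Real.exp (-(π * (ω * h).im)) * (0.1 / (2 * k + 3 : ℝ) ^ 2)) := by
  have hm : (2 * (k + 1 : ℕ) + 1 : ℝ) = 2 * k + 3 := by push_cast; ring
  have hk : (0 : ℝ) ≤ k := k.cast_nonneg
  have him : h.im ^ 2 ≤ 0.21 * h.re ^ 2 := by linarith [H.im_sq_le, sq_nonneg h.re]
  rcases le_total (2 * k + 3 : ℝ) (2.8 * ‖h‖) with hnear | hfar
  · refine (norm_vertGauss_shift_saddle_le H.re_pos him (k + 1)).trans ?_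
    rw [hm]
    exact mul_le_mul_of_nonneg_left (exp_sq_div_sub_mul_le (by linarith [hk]) H.le_ω_mul_im
      (by linarith [H.norm_le_ω_mul_im, H.ω_mul_im_pos])) (norm_nonneg _)
  · rw [vertGauss_eq_vertGauss (by linarith [H.one_lt_re_exponent]) _ H.re_pos
      (show 0 < (2 * (k + 1 : ℕ) + 1 : ℝ) * (√2 / 4) by positivity)]
    refine (norm_vertGauss_shift_far_le H.re_pos H.abs_im_exponent_le (k + 1)).trans ?_
    rw [hm]
    exact mul_le_mul_of_nonneg_left
      (mul_div_rpow_le H.le_norm (ω_mul_im_le_norm h) hfar H.le_re_exponent) (norm_nonneg _)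

theorem norm_hasSum_vertGauss_shift_succ_le {h S : ℂ} (H : InSector h)
    (hS : HasSum (fun k => vertGauss h.re (2 * π * h ^ 2) (shift (k + 1))) S) :
    ‖S‖ ≤ ‖saddle h‖ * (Real.exp (-(π * (ω * h).im)) * 0.05) := by
  refine le_of_tendsto hS.tendsto_sum_nat.norm (.of_forall fun n => ?_)
  refine (norm_sum_le_of_le _ fun k _ => norm_vertGauss_shift_succ_le H k).trans ?_
  rw [← Finset.mul_sum, ← Finset.mul_sum]
  gcongr
  exact sum_inv_odd_sq_le n

end Remainder

section LeadingTerm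

variable {h : ℂ}

theorem norm_exp_pi_mul_I_mul (z : ℂ) : ‖exp (π * I * z)‖ = Real.exp (-(π * z.im)) := by
  rw [norm_exp, mul_assoc, re_ofReal_mul, I_mul_re, mul_neg]

theorem norm_exp_neg_pi_mul_I_div_eight : ‖exp (-(π * I / 8))‖ = 1 := by
  rw [show (-(π * I / 8) : ℂ) = (-(π / 8) : ℝ) * I by push_cast; ring, norm_exp_ofReal_mul_I]

theorem saddle_ne_zero (hre : 0 < h.re) : saddle h ≠ 0 := by
  have h0 : h ≠ 0 := by
    rintro rfl
    simp at hre
  exact mul_ne_zero ((cpow_ne_zero_iff).mpr (.inl h0)) (exp_ne_zero _)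

/-- The leading term of `vertGauss h.re (2πh²) (shift 0)`. -/
def saddleTerm (h : ℂ) : ℂ := saddle h * (exp (-(π * I / 8)) * exp (π * I * (ω * h)) / √2)

theorem norm_saddleTerm (h : ℂ) :
    ‖saddleTerm h‖ = ‖saddle h‖ * Real.exp (-(π * (ω * h).im)) / √2 := by
  rw [saddleTerm, norm_mul, norm_div, norm_mul, norm_exp_neg_pi_mul_I_div_eight, one_mul,
    norm_exp_pi_mul_I_mul, norm_real, Real.norm_of_nonneg (Real.sqrt_nonneg _), mul_div_assoc]

theorem saddleTerm_ne_zero (hre : 0 < h.re) : saddleTerm h ≠ 0 :=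
  mul_ne_zero (saddle_ne_zero hre)
    (div_ne_zero (mul_ne_zero (exp_ne_zero _) (exp_ne_zero _)) (by simp))

theorem exists_vertGauss_shift_zero_eq (H : InSector h) :
    ∃ δ : ℂ, ‖δ‖ ≤ 0.31 ∧
      vertGauss h.re (2 * π * h ^ 2) (shift 0) = saddleTerm h * (1 + δ) := by
  obtain ⟨δ, hδ, hvert⟩ := exists_vertGauss_shift_zero_saddle_eq H.re_pos
    (by linarith [H.im_sq_le, sq_nonneg h.re])
  refine ⟨√2 * exp (-(π * I / 8)) * δ, ?_, ?_⟩
  · have hexp : Real.exp (π / 4) ≤ 2.7183 :=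
      (Real.exp_le_exp.mpr (by linarith [Real.pi_lt_d2])).trans
        (Real.exp_one_lt_d9.le.trans (by norm_num))
    calc ‖√2 * exp (-(π * I / 8)) * δ‖ = √2 * ‖δ‖ := by
          rw [norm_mul, norm_mul, norm_exp_neg_pi_mul_I_div_eight, norm_real,
            Real.norm_of_nonneg (Real.sqrt_nonneg _), mul_one]
      _ ≤ √2 * (2 * π / (3 * h.re) * (√2 * Real.exp (π / 4))) := by gcongr
      _ = 2 * π / (3 * h.re) * √2 ^ 2 * Real.exp (π / 4) := by ring
      _ = 2 * π / (3 * h.re) * 2 * Real.exp (π / 4) := by rw [Real.sq_sqrt zero_le_two]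
      _ ≤ 2 * 3.15 / (3 * 38) * 2 * 2.7183 := by
          gcongr
          · exact Real.pi_lt_d2.le
          · exact H.le_re
      _ ≤ 0.31 := by norm_num
  · have hquarter : exp (-(π * I / 4)) = exp (-(π * I / 8)) * exp (-(π * I / 8)) := by
      rw [← exp_add]
      ring_nf
    have hcancel : exp (-(π * I / 8)) * exp (π * I / 8) = 1 := by
      rw [← exp_add, neg_add_cancel, exp_zero]
    have hsqrt : (√2 : ℂ) ≠ 0 := by simp
    rw [hvert, saddleTerm, hquarter]
    field_simp
    linear_combination saddle h * hcancel

theorem exists_hasSum_vertGauss_eq {S : ℂ} (H : InSector h)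
    (hS : HasSum (fun k => vertGauss h.re (2 * π * h ^ 2) (shift k)) S) :
    ∃ δ : ℂ, ‖δ‖ ≤ 0.4 ∧ S = saddleTerm h * (1 + δ) := by
  obtain ⟨δ, hδ, hvert⟩ := exists_vertGauss_shift_zero_eq H
  have htail := (hasSum_nat_add_iff' 1).mpr hS
  rw [Finset.sum_range_one, hvert] at htail
  have hterm := saddleTerm_ne_zero H.re_pos
  have hR : ‖S - saddleTerm h * (1 + δ)‖ ≤ 0.08 * ‖saddleTerm h‖ := by
    have hsqrt : √2 ≤ 1.5 := (Real.sqrt_le_left (by norm_num)).mpr (by norm_num)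
    calc ‖S - saddleTerm h * (1 + δ)‖
        ≤ ‖saddle h‖ * (Real.exp (-(π * (ω * h).im)) * 0.05) :=
          norm_hasSum_vertGauss_shift_succ_le H htail
      _ = 0.05 * √2 * ‖saddleTerm h‖ := by
          rw [norm_saddleTerm]
          field_simp
      _ ≤ 0.08 * ‖saddleTerm h‖ := by
          gcongr
          linarith
  refine ⟨δ + (S - saddleTerm h * (1 + δ)) / saddleTerm h, ?_, ?_⟩
  · refine (norm_add_le _ _).trans ?_
    have := (div_le_iff₀ (norm_pos_iff.mpr hterm)).mpr hR
    rw [norm_div]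
    linarith
  · field_simp
    ring

/-- The leading term of `mellin kern (2πh²)`. -/
def leading (h : ℂ) : ℂ :=
  Gamma (2 * π * h ^ 2) * (2 * π : ℂ) ^ (-(2 * π * h ^ 2)) * (-2 * I * saddleTerm h)

theorem Gamma_mul_two_pi_cpow_ne_zero {w : ℂ} (hw : 0 < w.re) :
    Gamma w * (2 * π : ℂ) ^ (-w) ≠ 0 :=
  mul_ne_zero (Gamma_ne_zero_of_re_pos hw) (by simp [Real.pi_ne_zero])

theorem leading_ne_zero (H : InSector h) : leading h ≠ 0 :=
  mul_ne_zero (Gamma_mul_two_pi_cpow_ne_zero (zero_lt_one.trans H.one_lt_re_exponent))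
    (mul_ne_zero (by simp) (saddleTerm_ne_zero H.re_pos))

theorem exists_mellin_kern_eq (H : InSector h) :
    ∃ δ : ℂ, ‖δ‖ ≤ 0.4 ∧ mellin kern (2 * π * h ^ 2) = leading h * (1 + δ) := by
  have hpos := zero_lt_one.trans H.one_lt_re_exponent
  have hne := Gamma_mul_two_pi_cpow_ne_zero hpos
  have hsum := (hasSum_gaussMellin H.one_lt_re_exponent).mul_left
    (Gamma (2 * π * h ^ 2) * (2 * π : ℂ) ^ (-(2 * π * h ^ 2)))⁻¹
  simp only [gaussMellin_eq_vertGauss hpos _ H.re_pos, inv_mul_cancel_left₀ hne] at hsum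
  obtain ⟨δ, hδ, hS⟩ := exists_hasSum_vertGauss_eq H hsum
  refine ⟨δ, hδ, ?_⟩
  rw [inv_mul_eq_iff_eq_mul₀ hne] at hS
  rw [leading]
  linear_combination -2 * I * hS + mellin kern (2 * π * h ^ 2) * I_sq

end LeadingTerm

section SaddlePoint

/-- The saddle point for the parameter `s`: the principal square root of `(1 - s) / (2π)`, so that
`η(s) = ω * saddlePoint s`. -/
def saddlePoint (s : ℂ) : ℂ := ((1 - s) / (2 * π)) ^ (1 / 2 : ℂ)

theorem eta_eq_ω_mul (s : ℂ) : eta s = ω * saddlePoint s := rfl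

variable {s : ℂ}

theorem two_pi_mul_saddlePoint_sq (s : ℂ) : 2 * π * saddlePoint s ^ 2 = 1 - s := by
  have hpi : (π : ℂ) ≠ 0 := ofReal_ne_zero.mpr Real.pi_ne_zero
  have hsq : saddlePoint s ^ 2 = (1 - s) / (2 * π) := by
    rw [saddlePoint, one_div]
    exact cpow_nat_inv_pow _ two_ne_zero
  rw [hsq]
  field_simp

theorem re_div_two_pi_pos (hs : s ∈ region) : 0 < ((1 - s) / (2 * π)).re := by
  rw [show (1 - s) / (2 * π) = (1 - s) / (2 * π : ℝ) by push_cast; rfl, div_ofReal_re, sub_re,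
    one_re]
  exact div_pos ((abs_nonneg _).trans_lt hs.1) Real.two_pi_pos

theorem inSector_saddlePoint (hs : s ∈ region) : InSector (saddlePoint s) where
  re_pos := by
    rw [saddlePoint, one_div, cpow_inv_two_re, Real.sqrt_pos]
    exact half_pos (add_pos_of_nonneg_of_pos (norm_nonneg _) (re_div_two_pi_pos hs))
  abs_im_sq_le := by
    have hre := two_pi_mul_sq_re (saddlePoint s)
    have him := two_pi_mul_sq_im (saddlePoint s)
    rw [two_pi_mul_saddlePoint_sq, sub_re, one_re] at hre
    rw [two_pi_mul_saddlePoint_sq, sub_im, one_im, zero_sub] at him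
    have hlt := hs.1
    rw [hre, ← abs_neg, him, abs_mul, abs_of_pos Real.two_pi_pos] at hlt
    exact (lt_of_mul_lt_mul_left hlt Real.two_pi_pos.le).le
  le_norm := by
    have hnorm : ‖s - 1‖ = 2 * π * ‖saddlePoint s‖ ^ 2 := by
      rw [norm_sub_rev, ← two_pi_mul_saddlePoint_sq, norm_mul, norm_pow,
        show (2 * π : ℂ) = (2 * π : ℝ) by push_cast; rfl, norm_real,
        Real.norm_of_nonneg Real.two_pi_pos.le]
    have hsq : 42 ^ 2 ≤ ‖saddlePoint s‖ ^ 2 := by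
      refine le_of_mul_le_mul_left ?_ Real.two_pi_pos
      linarith [hs.2]
    exact le_of_sq_le_sq hsq (norm_nonneg _)

theorem one_lt_re_one_sub (hs : s ∈ region) : 1 < (1 - s).re :=
  two_pi_mul_saddlePoint_sq s ▸ (inSector_saddlePoint hs).one_lt_re_exponent

theorem re_lt_neg_one (hs : s ∈ region) : s.re < -1 := by
  have hexp := (inSector_saddlePoint hs).le_re_exponent
  rw [two_pi_mul_saddlePoint_sq, sub_re, one_re] at hexp
  nlinarith [(inSector_saddlePoint hs).le_norm]

end SaddlePoint

section Continuity

theorem norm_kern_le {y : ℝ} (hy : 0 < y) : ‖kern y‖ ≤ Real.exp (-(π * y ^ 2)) * y⁻¹ := by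
  have hsin : y ≤ ‖sin (π * (ω * y))‖ := by
    calc y ≤ π * (√2 / 2 * y) := by
          have hsqrt : 1 ≤ √2 := Real.one_le_sqrt.mpr one_le_two
          nlinarith [Real.pi_gt_three, mul_pos hy Real.pi_pos]
      _ = (π * (ω * y)).im := by
          rw [im_ofReal_mul, ω_mul_im, ofReal_re, ofReal_im, add_zero]
      _ ≤ ‖sin (π * (ω * y))‖ := (le_abs_self _).trans (abs_im_le_norm_sin _)
  rw [kern, norm_div, norm_exp, ← ofReal_pow, ← ofReal_mul, ← ofReal_neg, ofReal_re,
    div_eq_mul_inv]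
  gcongr

theorem continuousOn_kern : ContinuousOn kern (Ioi 0) := by
  intro y hy
  have hsin : sin (π * (ω * y)) ≠ 0 := by
    rw [← norm_pos_iff]
    refine (abs_pos.mpr ?_).trans_le (abs_im_le_norm_sin _)
    rw [im_ofReal_mul, ω_mul_im, ofReal_re, ofReal_im, add_zero]
    have := mem_Ioi.mp hy
    positivity
  refine ContinuousAt.continuousWithinAt ?_
  unfold kern
  exact ContinuousAt.div (by fun_prop) (by fun_prop) hsin

theorem continuousAt_mellin_kern {w : ℂ} (hw : 1 < w.re) : ContinuousAt (mellin kern) w := by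
  refine (mellin_differentiableAt_of_isBigO_rpow_exp (a := 1) (b := 1) one_pos
    (continuousOn_kern.locallyIntegrableOn measurableSet_Ioi) ?_ ?_ hw).continuousAt
  · refine Asymptotics.IsBigO.of_bound 1 ?_
    filter_upwards [eventually_ge_atTop (1 : ℝ)] with y hy
    calc ‖kern y‖ ≤ Real.exp (-(π * y ^ 2)) * y⁻¹ := norm_kern_le (by linarith)
      _ ≤ Real.exp (-1 * y) * 1 := by
          gcongr
          · nlinarith [Real.pi_gt_three]
          · exact inv_le_one_of_one_le₀ hy
      _ = 1 * ‖Real.exp (-1 * y)‖ := by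
          rw [Real.norm_of_nonneg (Real.exp_pos _).le, mul_comm]
  · refine Asymptotics.IsBigO.of_bound 1 ?_
    filter_upwards [self_mem_nhdsWithin] with y hy
    have hy : 0 < y := hy
    calc ‖kern y‖ ≤ Real.exp (-(π * y ^ 2)) * y⁻¹ := norm_kern_le hy
      _ ≤ 1 * y⁻¹ := by
          gcongr
          exact Real.exp_le_one_iff.mpr (neg_nonpos.mpr (by positivity))
      _ = 1 * ‖y ^ (-1 : ℝ)‖ := by
          rw [Real.rpow_neg_one, Real.norm_of_nonneg (by positivity)]

theorem continuousAt_saddleTerm {h : ℂ} (hre : 0 < h.re) : ContinuousAt saddleTerm h := by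
  have hpow : ContinuousAt (fun h : ℂ => h ^ (-(2 * π * h ^ 2))) h :=
    continuousAt_id.cpow (by fun_prop) (.inl hre)
  unfold saddleTerm saddle
  fun_prop

theorem continuousAt_leading {h : ℂ} (hre : 0 < h.re) (hw : 0 < (2 * π * h ^ 2 : ℂ).re) :
    ContinuousAt leading h := by
  have hGamma : ContinuousAt Gamma (2 * π * h ^ 2) := by
    refine (differentiableAt_Gamma _ fun m hm => ?_).continuousAt
    rw [hm, neg_re, natCast_re] at hw
    linarith [(m.cast_nonneg : (0 : ℝ) ≤ m)]
  have hGammaComp : ContinuousAt (fun h : ℂ => Gamma (2 * π * h ^ 2)) h :=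
    hGamma.comp (f := fun h : ℂ => 2 * π * h ^ 2) (by fun_prop)
  have hpow : ContinuousAt (fun h : ℂ => (2 * π : ℂ) ^ (-(2 * π * h ^ 2))) h :=
    ContinuousAt.const_cpow (by fun_prop) (.inl (by simp [Real.pi_ne_zero]))
  have hterm := continuousAt_saddleTerm hre
  unfold leading
  fun_prop

theorem continuousAt_saddlePoint {s : ℂ} (hs : s ∈ region) : ContinuousAt saddlePoint s :=
  ContinuousAt.cpow (by fun_prop) continuousAt_const (.inl (re_div_two_pi_pos hs))

end Continuity

section RelativeError

variable {s : ℂ}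

theorem norm_exp_eta_sq_le (hs : s ∈ region) : ‖exp (π * I * eta s) ^ 2‖ ≤ 0.02 := by
  rw [norm_pow, norm_exp_pi_mul_I_mul, eta_eq_ω_mul, ← Real.exp_nat_mul, mul_neg, Real.exp_neg]
  have him := (inSector_saddlePoint hs).le_ω_mul_im
  have hexp := Real.add_one_le_exp ((2 : ℕ) * (π * (ω * saddlePoint s).im))
  rw [Nat.cast_ofNat] at hexp ⊢
  rw [inv_le_comm₀ (Real.exp_pos _) (by norm_num)]
  nlinarith [Real.pi_gt_three]

theorem one_sub_exp_eta_sq_ne_zero (hs : s ∈ region) : 1 - exp (π * I * eta s) ^ 2 ≠ 0 := by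
  intro h0
  have hle := norm_exp_eta_sq_le hs
  rw [← sub_eq_zero.mp h0] at hle
  norm_num at hle

theorem one_add_exp_eta_pow_four_ne_zero (hs : s ∈ region) :
    1 + exp (π * I * eta s) ^ 4 ≠ 0 := by
  intro h0
  have hle := norm_exp_eta_sq_le hs
  have hnorm : ‖exp (π * I * eta s) ^ 2‖ ^ 2 = 1 := by
    rw [← norm_pow, ← pow_mul, eq_neg_of_add_eq_zero_right h0, norm_neg, norm_one]
  nlinarith [norm_nonneg (exp (π * I * eta s) ^ 2)]

/-- The function `U` of the theorem. The leading term of the Mellin transform of `kern` carries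
`exp (π * I * η)` where the main term has `sin πη / cos 2πη`; the second factor makes up for
this. -/
def relErr (s : ℂ) : ℂ :=
  mellin kern (1 - s) / leading (saddlePoint s) *
    ((1 + exp (π * I * eta s) ^ 4) / (1 - exp (π * I * eta s) ^ 2)) - 1

theorem norm_mul_div_sub_one_lt {δ e : ℂ} (hδ : ‖δ‖ ≤ 0.4) (he : ‖e‖ ≤ 0.02) :
    ‖(1 + δ) * ((1 + e ^ 2) / (1 - e)) - 1‖ < 1 := by
  have hden : 0.98 ≤ ‖1 - e‖ := by
    have := norm_sub_norm_le 1 e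
    rw [norm_one] at this
    linarith
  have hne : 1 - e ≠ 0 := norm_pos_iff.mp (by linarith)
  have hsq : ‖e ^ 2‖ ≤ 0.0004 := by
    rw [norm_pow]
    nlinarith [norm_nonneg e]
  have hone_add : ‖1 + e ^ 2‖ ≤ 1.0004 := by
    have := norm_add_le 1 (e ^ 2)
    rw [norm_one] at this
    linarith
  have hmul : ‖δ * (1 + e ^ 2)‖ ≤ 0.4 * 1.0004 := by
    rw [norm_mul]
    gcongr
  have hquot : (1 + δ) * ((1 + e ^ 2) / (1 - e)) - 1 = (δ * (1 + e ^ 2) + e ^ 2 + e) / (1 - e) := by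
    field_simp
    ring
  rw [hquot, norm_div, div_lt_one (norm_pos_iff.mpr hne)]
  linarith [norm_add₃_le (a := δ * (1 + e ^ 2)) (b := e ^ 2) (c := e)]

theorem norm_relErr_lt (hs : s ∈ region) : ‖relErr s‖ < 1 := by
  obtain ⟨δ, hδ, hmellin⟩ := exists_mellin_kern_eq (inSector_saddlePoint hs)
  rw [two_pi_mul_saddlePoint_sq] at hmellin
  rw [relErr, hmellin, mul_div_cancel_left₀ _ (leading_ne_zero (inSector_saddlePoint hs)),
    show exp (π * I * eta s) ^ 4 = (exp (π * I * eta s) ^ 2) ^ 2 from pow_mul _ 2 2]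
  exact norm_mul_div_sub_one_lt hδ (norm_exp_eta_sq_le hs)

theorem one_add_relErr_ne_zero (hs : s ∈ region) : 1 + relErr s ≠ 0 := by
  intro h0
  have hlt := norm_relErr_lt hs
  rw [eq_neg_of_add_eq_zero_right h0, norm_neg, norm_one] at hlt
  exact lt_irrefl _ hlt

theorem continuousOn_relErr : ContinuousOn relErr region := by
  intro s hs
  refine ContinuousAt.continuousWithinAt ?_
  have hsector := inSector_saddlePoint hs
  have hpoint := continuousAt_saddlePoint hs
  have hmellin : ContinuousAt (fun s : ℂ => mellin kern (1 - s)) s :=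
    (continuousAt_mellin_kern (one_lt_re_one_sub hs)).comp (f := fun s : ℂ => 1 - s) (by fun_prop)
  have hleading : ContinuousAt (fun s : ℂ => leading (saddlePoint s)) s :=
    (continuousAt_leading hsector.re_pos
      (zero_lt_one.trans hsector.one_lt_re_exponent)).comp hpoint
  have heta : ContinuousAt eta s := hpoint.const_mul ω
  unfold relErr
  exact ((hmellin.div hleading (leading_ne_zero hsector)).mul
    (ContinuousAt.div (by fun_prop) (by fun_prop) (one_sub_exp_eta_sq_ne_zero hs))).sub
      continuousAt_const

end RelativeError

section MainTerm

theorem chi_eq (s : ℂ) :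
    chi s = 2 * (2 * π : ℂ) ^ (-(1 - s)) * sin (π * s / 2) * Gamma (1 - s) := by
  have hmul : (2 * π : ℂ) ^ (-(1 - s)) = 2 ^ (s - 1) * (π : ℂ) ^ (s - 1) := by
    rw [neg_sub]
    exact_mod_cast mul_cpow_ofReal_nonneg zero_le_two Real.pi_pos.le (s - 1)
  rw [chi, hmul, cpow_sub _ _ two_ne_zero, cpow_one]
  ring

theorem sin_div_two_mul_cos_eq {z : ℂ} (hz : 1 + exp (π * I * z) ^ 4 ≠ 0) :
    sin (π * z) / (2 * cos (2 * π * z)) =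
      I / 2 * exp (π * I * z) * ((1 - exp (π * I * z) ^ 2) / (1 + exp (π * I * z) ^ 4)) := by
  have hexp := exp_ne_zero (π * I * z)
  have hsin : sin (π * z) = ((exp (π * I * z))⁻¹ - exp (π * I * z)) * I / 2 := by
    rw [sin, ← exp_neg]
    ring_nf
  have hcos : cos (2 * π * z) = (exp (π * I * z) ^ 2 + (exp (π * I * z) ^ 2)⁻¹) / 2 := by
    rw [cos, ← exp_nat_mul, ← exp_neg]
    push_cast
    ring_nf
  rw [hsin, hcos]
  generalize exp (π * I * z) = u at *
  have hden : u ^ 2 + (u ^ 2)⁻¹ = (1 + u ^ 4) * (u ^ 2)⁻¹ := by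
    field_simp
    ring
  rw [hden]
  field_simp

theorem exp_pi_div_two_mul_I_add (z : ℂ) : exp (π / 2 * I + z) = I * exp z := by
  rw [exp_add, exp_pi_div_two_mul_I]

variable {s : ℂ}

theorem eta_cpow (hs : s ∈ region) :
    eta s ^ (s - 1) = exp (-(π * I * (1 - s) / 4)) * saddlePoint s ^ (-(1 - s)) := by
  have hre := (inSector_saddlePoint hs).re_pos
  have hne : saddlePoint s ≠ 0 := by
    intro h0
    simp [h0] at hre
  have harg := abs_lt.mp (abs_arg_lt_pi_div_two_iff.mpr (.inl hre))
  have hmem : π / 4 + (saddlePoint s).arg ∈ Ioc (-π) π := by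
    constructor <;> linarith [Real.pi_pos]
  rw [eta_eq_ω_mul, ω_eq_exp_mul_I, exp_mul_I_mul_cpow hne hmem, neg_sub]
  push_cast
  ring_nf

theorem mainTerm_eq (hs : s ∈ region) :
    mainTerm s = exp (π * I * (s + 1) / 4) * sin (π * s / 2) * leading (saddlePoint s) *
      ((1 - exp (π * I * eta s) ^ 2) / (1 + exp (π * I * eta s) ^ 4)) := by
  have hgauss : -(π * I * eta s ^ 2) = π * saddlePoint s ^ 2 := by
    rw [eta_eq_ω_mul, mul_pow, ω_sq]
    linear_combination (-(π * saddlePoint s ^ 2) : ℂ) * I_sq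
  have hphase : exp (π * I * (s + 1) / 4) = I * exp (-(π * I * (1 - s) / 4)) := by
    rw [← exp_pi_div_two_mul_I_add]
    ring_nf
  have hconst : exp (3 * π * I / 8) = I * exp (-(π * I / 8)) := by
    rw [← exp_pi_div_two_mul_I_add]
    ring_nf
  have hsqrt : (√2 : ℂ) = 2 / √2 := by
    rw [eq_div_iff (by simp)]
    exact_mod_cast Real.mul_self_sqrt zero_le_two
  rw [mainTerm, chi_eq, eta_cpow hs, hgauss, hphase, hconst, mul_div_assoc (_ * _) (sin _),
    sin_div_two_mul_cos_eq (one_add_exp_eta_pow_four_ne_zero hs), hsqrt, leading, saddleTerm,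
    saddle, two_pi_mul_saddlePoint_sq, ← eta_eq_ω_mul]
  ring

theorem auxR_eq_mainTerm_mul (hs : s ∈ region) : auxR s = mainTerm s * (1 + relErr s) := by
  have hleading := leading_ne_zero (inSector_saddlePoint hs)
  have hnum := one_sub_exp_eta_sq_ne_zero hs
  have hden := one_add_exp_eta_pow_four_ne_zero hs
  rw [auxR_eq_mellin_kern (re_lt_neg_one hs), mainTerm_eq hs, relErr, add_sub_cancel]
  field_simp

theorem sin_pi_mul_div_two_eq_zero_iff (hs : s.re < 0) :
    sin (π * s / 2) = 0 ↔ ∃ n : ℕ, 0 < n ∧ s = -2 * n := by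
  have hpi : (π : ℂ) ≠ 0 := ofReal_ne_zero.mpr Real.pi_ne_zero
  rw [sin_eq_zero_iff]
  constructor
  · rintro ⟨k, hk⟩
    have hsk : s = 2 * k := mul_left_cancel₀ hpi (by linear_combination 2 * hk)
    have hk_neg : k < 0 := by
      have hre : s.re = 2 * k := by simp [hsk]
      exact_mod_cast (by linarith : (k : ℝ) < 0)
    refine ⟨k.natAbs, by lia, ?_⟩
    rw [hsk, Nat.cast_natAbs, abs_of_neg hk_neg]
    push_cast
    ring
  · rintro ⟨n, -, rfl⟩
    refine ⟨-n, ?_⟩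
    push_cast
    ring

theorem mainTerm_eq_zero_iff (hs : s ∈ region) :
    mainTerm s = 0 ↔ ∃ n : ℕ, 0 < n ∧ s = -2 * n := by
  have hfactor := div_ne_zero (one_sub_exp_eta_sq_ne_zero hs) (one_add_exp_eta_pow_four_ne_zero hs)
  rw [mainTerm_eq hs, mul_eq_zero, or_iff_left hfactor, mul_eq_zero,
    or_iff_left (leading_ne_zero (inSector_saddlePoint hs)), mul_eq_zero,
    or_iff_right (exp_ne_zero _), sin_pi_mul_div_two_eq_zero_iff]
  linarith [re_lt_neg_one hs]

end MainTerm

end RiemannAux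

end

theorem mainTheorem5 :
    (∀ s ∈ RiemannAux.region,
      RiemannAux.auxR s = 0 ↔ ∃ n : ℕ, 0 < n ∧ s = -2 * (n : ℂ)) ∧
    ∃ U : ℂ → ℂ, ContinuousOn U RiemannAux.region ∧
      ∀ s ∈ RiemannAux.region,
        RiemannAux.auxR s = RiemannAux.mainTerm s * (1 + U s) ∧ ‖U s‖ < 1 := by
  refine ⟨fun s hs => ?_, RiemannAux.relErr, RiemannAux.continuousOn_relErr,
    fun s hs => ⟨RiemannAux.auxR_eq_mainTerm_mul hs, RiemannAux.norm_relErr_lt hs⟩⟩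
  rw [RiemannAux.auxR_eq_mainTerm_mul hs, mul_eq_zero,
    or_iff_left (RiemannAux.one_add_relErr_ne_zero hs), RiemannAux.mainTerm_eq_zero_iff hs]
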